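/- Let $K$ be an algebraically closed field of characteristic zero and let $f(Y)\in K[[X_1,\dots,X_d]][Y]$ be an irreducible quasi-ordinary Weierstrass polynomial, i.e. $f$ is monic, its non-leading coefficients vanish at the origin, and its $Y$-discriminant has the form $X_1^{\alpha_1}\cdots X_d^{\alpha_d}u$ with $\alpha_i\in\mathbb N$, $u(0)\neq0$. For any quasi-ordinary Weierstrass polynomial $p$, let $\mathrm{Zer}\,p$ be the set of its roots in $\bigcup_{k\ge1}K[[X_1^{1/k},\dots,X_d^{1/k}]]$. For distinct roots write $Y_i-Y_j=X^{\lambda}u$ with $\lambda\in\mathbb Q_{\ge0}^d$, $u(0)\ne0$, and call $O(Y_i,Y_j)=\lambda$ their contact; put $O(Y_i,Y_i)=\infty$. Order $\mathbb Q^d$ componentwise, with $\alpha<\infty$ for all $\alpha\in\mathbb Q^d$. The tree model $T(p)$ is defined as follows. The set $\mathrm{Zer}\,p$ (if non-empty) is a bar; the height $h(B)$ of a bar $B$ is the smallest contact between elements of $B$ (so one-element bars have height $\infty$); if $h(B)$ is finite, the equivalence classes of the relation $O(Y_i,Y_j)>h(B)$ on $B$ are called the postbars of $B$, and they are again bars.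 All bars are obtained from $\mathrm{Zer}\,p$ in this way. Let $h_1<\dots<h_g$ be the sequence of characteristic exponents of $f$, that is, $\{O(Y_j,Y_i): Y_j\in\mathrm{Zer}\,f,\ Y_j\neq Y_i\}=\{h_1,\dots,h_g\}$ for a root $Y_i$ of $f$ (for irreducible $f$ this set does not depend on $Y_i$). Put $h_{g+1}=\infty$, $N_0=\mathbb Z^d$ and $N_i=\mathbb Z^d+\mathbb Z h_1+\dots+\mathbb Z h_i$ for $1\le i\le g$. Then the tree model $T(f)$ is characterized by the following two properties: (i) the set of heights of bars of $T(f)$ is $\{h_1,\dots,h_g,h_{g+1}\}$; (ii) for $i=1,\dots,g$, every bar of height $h_i$ has exactly $[N_i:N_{i-1}]$ postbars, and all of them have height $h_{i+1}$. That is, $T(f)$ has properties (i) and (ii), and if $p\in K[[X_1,\dots,X_d]][Y]$ is any quasi-ordinary Weierstrass polynomial whose tree model $T(p)$ has properties (i) and (ii) for the same $h_1,\dots,h_g$, then there is a bijection between the bars of $T(f)$ and the bars of $T(p)$ that preserves heights and, in both directions, the relation of being a postbar. -/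

import Mathlib

namespace QuasiOrdinary

noncomputable section

/-! ### Quasi-ordinary Weierstrass polynomials -/

/-- A Weierstrass polynomial in `K[[X₁,…,X_d]][Y]`: a monic polynomial all of whose coefficients
other than the leading one vanish at the origin. -/
def IsWeierstrass {K : Type*} [Field K] {d : ℕ}
    (f : Polynomial (MvPowerSeries (Fin d) K)) : Prop :=
  f.Monic ∧ ∀ i < f.natDegree, MvPowerSeries.constantCoeff (f.coeff i) = 0

/-- The discriminant of `f` is a monomial `X₁^α₁ ⋯ X_d^α_d` times a power series with non-zero
constant term. -/
def IsQuasiOrdinary {K : Type*} [Field K] {d : ℕ}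
    (f : Polynomial (MvPowerSeries (Fin d) K)) : Prop :=
  ∃ (α : Fin d →₀ ℕ) (u : MvPowerSeries (Fin d) K),
    MvPowerSeries.constantCoeff u ≠ 0 ∧ f.discr = MvPowerSeries.monomial α 1 * u

/-! ### Power series with fractional exponents -/

/-- The map `n ↦ n / k` from `ℕ^d` to `ℚ^d`. -/
def divExp (d : ℕ) (k : ℕ+) : (Fin d →₀ ℕ) →+ (Fin d → ℚ) where
  toFun n := fun i => (n i : ℚ) / (k : ℚ)
  map_zero' := by
    funext i
    simp
  map_add' m n := by
    funext i
    simp [add_div]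

theorem divExp_le_iff (d : ℕ) (k : ℕ+) (m n : Fin d →₀ ℕ) :
    divExp d k m ≤ divExp d k n ↔ m ≤ n := by
  have hk : (0 : ℚ) < (k : ℚ) := by exact_mod_cast k.pos
  constructor
  · intro h i
    have hi : (m i : ℚ) / (k : ℚ) ≤ (n i : ℚ) / (k : ℚ) := h i
    rw [div_le_div_iff_of_pos_right hk] at hi
    exact_mod_cast hi
  · intro h i
    change (m i : ℚ) / (k : ℚ) ≤ (n i : ℚ) / (k : ℚ)
    rw [div_le_div_iff_of_pos_right hk]
    exact_mod_cast h i

theorem divExp_injective (d : ℕ) (k : ℕ+) : Function.Injective (divExp d k) := fun m n h =>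
  le_antisymm ((divExp_le_iff d k m n).1 h.le) ((divExp_le_iff d k n m).1 h.ge)

/-- The ring homomorphism `φ(X₁,…,X_d) ↦ φ(X₁^{1/k},…,X_d^{1/k})`, with values in the ring of Hahn
series with exponents in `ℚ^d` (ordered componentwise). It is injective and its range is
`K[[X₁^{1/k},…,X_d^{1/k}]]`; for `k = 1` it is the inclusion of `K[[X₁,…,X_d]]`. -/
def fracSeries (K : Type*) [Field K] (d : ℕ) (k : ℕ+) :
    MvPowerSeries (Fin d) K →+* HahnSeries (Fin d → ℚ) K :=
  (HahnSeries.embDomainRingHom (divExp d k) (divExp_injective d k) (divExp_le_iff d k)).comp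
    (HahnSeries.toMvPowerSeries (R := K) (σ := Fin d)).symm.toRingHom

/-- `Zer f`: the set of roots of `f` that lie in `K[[X₁^{1/k},…,X_d^{1/k}]]` for some `k ≥ 1`. -/
def Zer {K : Type*} [Field K] {d : ℕ} (f : Polynomial (MvPowerSeries (Fin d) K)) :
    Set (HahnSeries (Fin d → ℚ) K) :=
  {Y | (∃ k : ℕ+, Y ∈ (fracSeries K d k).range) ∧ f.eval₂ (fracSeries K d 1) Y = 0}

/-! ### Contacts and the tree model -/

/-- `HasContact Y Y' c` means `O(Y, Y') = c`. The contact of `Y` with itself is `∞`; otherwise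
`O(Y, Y') = n / k` if `Y - Y' = X^{n/k} u` with `u ∈ K[[X₁^{1/k},…,X_d^{1/k}]]`, `u(0) ≠ 0`. -/
def HasContact {K : Type*} [Field K] {d : ℕ} (Y Y' : HahnSeries (Fin d → ℚ) K)
    (c : WithTop (Fin d → ℚ)) : Prop :=
  (Y = Y' ∧ c = ⊤) ∨
    ∃ (k : ℕ+) (n : Fin d →₀ ℕ) (u : MvPowerSeries (Fin d) K),
      MvPowerSeries.constantCoeff u ≠ 0 ∧
      Y - Y' = fracSeries K d k (MvPowerSeries.monomial n 1 * u) ∧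
      c = ((divExp d k n : Fin d → ℚ) : WithTop (Fin d → ℚ))

/-- `HasHeight B c` means `h(B) = c`: the smallest contact between elements of `B` is `c`. -/
def HasHeight {K : Type*} [Field K] {d : ℕ} (B : Set (HahnSeries (Fin d → ℚ) K))
    (c : WithTop (Fin d → ℚ)) : Prop :=
  IsLeast {c' | ∃ Y ∈ B, ∃ Y' ∈ B, HasContact Y Y' c'} c

/-- `B ⊥ B'`: the height of `B` is a finite `η`, and `B'` is an equivalence class of the relation
`O(Y, Y') > η` on `B`. -/
def IsPostbar {K : Type*} [Field K] {d : ℕ} (B B' : Set (HahnSeries (Fin d → ℚ) K)) : Prop :=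
  ∃ η : Fin d → ℚ, HasHeight B (η : WithTop (Fin d → ℚ)) ∧
    ∃ Y ∈ B, B' = {Y' ∈ B | ∃ c, HasContact Y Y' c ∧ (η : WithTop (Fin d → ℚ)) < c}

/-- The bars of the tree model built on a set `Z` of fractional power series: `Z` itself, and
recursively the postbars of bars. The tree model `T(f)` consists of the bars with `Z = Zer f`,
their heights and the relation `IsPostbar`. Bars of infinite height are included. -/
inductive IsBar {K : Type*} [Field K] {d : ℕ} (Z : Set (HahnSeries (Fin d → ℚ) K)) :
    Set (HahnSeries (Fin d → ℚ) K) → Prop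
  | root : Z.Nonempty → IsBar Z Z
  | postbar {B B' : Set (HahnSeries (Fin d → ℚ) K)} : IsBar Z B → IsPostbar B B' → IsBar Z B'

/-! ### Characteristic exponents -/

/-- `h₁ < ⋯ < h_g` is the sequence of characteristic exponents of `f`: for a root `Y` of `f`, the
set of the contacts of `Y` with the other roots of `f` is `{h₁,…,h_g}`. (For irreducible
quasi-ordinary `f` this set does not depend on the choice of `Y`.) Here `h i` is `h_{i+1}`. -/
def IsCharSeq {K : Type*} [Field K] {d : ℕ} (f : Polynomial (MvPowerSeries (Fin d) K)) {g : ℕ}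
    (h : Fin g → (Fin d → ℚ)) : Prop :=
  StrictMono h ∧ ∃ Y ∈ Zer f,
    {c | ∃ Y' ∈ Zer f, Y' ≠ Y ∧ HasContact Y' Y c} =
      Set.range fun i => ((h i : Fin d → ℚ) : WithTop (Fin d → ℚ))

/-- The lattice `N_i = ℤ^d + ℤ h₁ + ⋯ + ℤ h_i`. -/
def charLattice {d g : ℕ} (h : Fin g → (Fin d → ℚ)) (i : ℕ) : AddSubgroup (Fin d → ℚ) :=
  AddSubgroup.closure
    ({v | ∃ m : Fin d → ℤ, v = fun l => (m l : ℚ)} ∪ {v | ∃ j : Fin g, (j : ℕ) < i ∧ v = h j})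

/-- The sequence `h₁,…,h_g` extended by `∞`, with indices starting at `0`. -/
def extSeq {d g : ℕ} (h : Fin g → (Fin d → ℚ)) (i : ℕ) : WithTop (Fin d → ℚ) :=
  if hi : i < g then ((h ⟨i, hi⟩ : Fin d → ℚ) : WithTop (Fin d → ℚ)) else ⊤

/-- The tree model built on `Z` is of type `(h₁,…,h_g)`: every bar has a height, the set of heights
of bars is `{h₁,…,h_g,h_{g+1}}` with `h_{g+1} = ∞`, and, for `1 ≤ i ≤ g`, every bar of height `h_i`
has exactly `[N_i : N_{i-1}]` postbars, all of height `h_{i+1}`. -/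
structure IsTreeOfType {K : Type*} [Field K] {d g : ℕ} (Z : Set (HahnSeries (Fin d → ℚ) K))
    (h : Fin g → (Fin d → ℚ)) : Prop where
  hasHeight : ∀ B, IsBar Z B → ∃ c, HasHeight B c
  heights : {c | ∃ B, IsBar Z B ∧ HasHeight B c} =
    insert ⊤ (Set.range fun i => ((h i : Fin d → ℚ) : WithTop (Fin d → ℚ)))
  postbars : ∀ (i : Fin g) (B), IsBar Z B → HasHeight B ((h i : Fin d → ℚ) : WithTop _) →
    {B' | IsPostbar B B'}.encard =
        (((charLattice h i).relIndex (charLattice h (i + 1)) : ℕ) : ℕ∞) ∧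
      ∀ B', IsPostbar B B' → HasHeight B' (extSeq h (i + 1))

/-- The tree models built on `Z` and `Z'` are equal as trees with heights: there is a bijection
between their bars that preserves heights and the postbar relation in both directions. -/
def TreeEquiv {K : Type*} [Field K] {d : ℕ} (Z Z' : Set (HahnSeries (Fin d → ℚ) K)) : Prop :=
  ∃ e : {B // IsBar Z B} ≃ {B // IsBar Z' B},
    (∀ B B', IsPostbar B.1 B'.1 ↔ IsPostbar (e B).1 (e B').1) ∧
    ∀ B c, HasHeight B.1 c ↔ HasHeight (e B).1 c

end

end QuasiOrdinary

namespace QuasiOrdinary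

noncomputable section

/-! ### Divisors of monomials times units -/

/-! The characters `χ` of `ℚ^d` with values in `Kˣ`, trivial on `ℤ^d`, act on fractional power
series by `X^q ↦ χ(q) X^q` and serve as a Galois group. Since `Kˣ` is divisible and contains
primitive roots of unity of every order, the series fixed by all of them are exactly the elements of
`K[[X]]` (`mem_range_of_twist_eq`). The orbit polynomial of a root therefore descends to a factor of
`f`, and irreducibility makes the roots a single orbit (`exists_twist_eq`).

Any two roots have a contact: their difference divides the discriminant (`sub_dvd_discr`), and a
divisor of a monomial times a unit has the same form. The contact is the least exponent of the
difference, so it is invariant under the action and satisfies an ultrametric inequality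
(`contact_le_or`). Hence every root sees the same contacts, and the bars are the sets of roots whose
contact with a given root is at least a given term of the sequence.

The conjugate of a root `x` by `χ` lies in the bar of `x` at a given level exactly when `χ` kills
the lattice of the earlier exponents. The postbars of this bar are told apart by the coefficient at
the next exponent `a`. This coefficient takes the values `χ(a)` times that of `x`, and their number
is the order of `a` modulo the lattice, which is the required index (`encard_postbars`).

For uniqueness, postbars of bars of equal height are equally numerous. Matching them arbitrarily and
gluing, from height `∞` downwards, gives a contact preserving bijection of the roots
(`IsTreeOfType.exists_bijOn`), which induces one of the trees. -/

theorem prime_X {σ K : Type*} [Field K] (s : σ) : Prime (MvPowerSeries.X s : MvPowerSeries σ K) := by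
  classical
  -- Every series is congruent modulo `X s` to one free of `X s`. A product of two such
  -- representatives is again free of `X s`, so if `X s` divides it, it is zero.
  have key : ∀ φ : MvPowerSeries σ K, ∃ φ₀ : MvPowerSeries σ K,
      (∀ m : σ →₀ ℕ, m s ≠ 0 → MvPowerSeries.coeff m φ₀ = 0) ∧ MvPowerSeries.X s ∣ φ - φ₀ := by
    intro φ
    obtain ⟨φ₀, hφ₀⟩ : ∃ φ₀ : MvPowerSeries σ K, ∀ m, MvPowerSeries.coeff m φ₀ =
        if m s = 0 then MvPowerSeries.coeff m φ else 0 := ⟨fun m => _, fun m => rfl⟩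
    refine ⟨φ₀, fun m hm => by rw [hφ₀, if_neg hm], ?_⟩
    rw [MvPowerSeries.X_dvd_iff]
    intro m hm
    rw [map_sub, sub_eq_zero, hφ₀, if_pos hm]
  refine ⟨fun h => ?_, fun h => ?_, fun φ ψ h => ?_⟩
  · have := congrArg (MvPowerSeries.coeff (Finsupp.single s 1)) h
    rw [MvPowerSeries.coeff_index_single_self_X] at this
    simp at this
  · have := MvPowerSeries.isUnit_iff_constantCoeff.1 h
    simp at this
  · obtain ⟨φ₀, hφ, q, hq⟩ := key φ
    obtain ⟨ψ₀, hψ, r, hr⟩ := key ψ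
    have h1 : MvPowerSeries.X s ∣ φ₀ * ψ₀ := by
      have : φ₀ * ψ₀ = φ * ψ - MvPowerSeries.X s * (q * ψ + φ₀ * r) := by
        linear_combination (-ψ) * hq - φ₀ * hr
      rw [this]
      exact dvd_sub h (dvd_mul_right _ _)
    have h2 : φ₀ * ψ₀ = 0 := by
      ext m
      by_cases hm : m s = 0
      · exact MvPowerSeries.X_dvd_iff.1 h1 m hm
      · rw [MvPowerSeries.coeff_mul, map_zero]
        refine Finset.sum_eq_zero fun x hx => ?_
        rw [Finset.HasAntidiagonal.mem_antidiagonal] at hx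
        by_cases hx1 : x.1 s = 0
        · rw [hψ x.2, mul_zero]
          intro hx2
          apply hm
          rw [← hx, Finsupp.add_apply, hx1, hx2]
        · rw [hφ _ hx1, zero_mul]
    rcases mul_eq_zero.1 h2 with h3 | h3
    · left
      rw [h3, sub_zero] at hq
      exact ⟨q, hq⟩
    · right
      rw [h3, sub_zero] at hr
      exact ⟨r, hr⟩

theorem monomial_add_eq_mul {σ K : Type*} [Field K] (m n : σ →₀ ℕ) :
    (MvPowerSeries.monomial (m + n) (1 : K)) =
      MvPowerSeries.monomial m 1 * MvPowerSeries.monomial n 1 := by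
  rw [MvPowerSeries.monomial_mul_monomial, one_mul]

/-- A divisor of a monomial times a unit is a monomial times a unit. -/
theorem exists_eq_monomial_mul_of_mul_eq {σ K : Type*} [Field K] (n : σ →₀ ℕ)
    (a b u : MvPowerSeries σ K) (hu : MvPowerSeries.constantCoeff u ≠ 0)
    (hab : a * b = MvPowerSeries.monomial n 1 * u) :
    ∃ (m : σ →₀ ℕ) (v : MvPowerSeries σ K), MvPowerSeries.constantCoeff v ≠ 0 ∧
      a = MvPowerSeries.monomial m 1 * v := by
  -- Induction on the total degree: a variable occurring in the monomial is prime, so it divides `a`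
  -- or `b` and can be cancelled.
  induction hN : n.degree using Nat.strong_induction_on generalizing n a b with
  | _ N ih =>
    by_cases hn : n = 0
    · subst hn
      refine ⟨0, a, fun ha => hu ?_, ?_⟩
      · have := congrArg MvPowerSeries.constantCoeff hab
        rw [map_mul, ha, zero_mul, map_mul] at this
        simpa using this.symm
      · rw [MvPowerSeries.monomial_zero_one, one_mul]
    · obtain ⟨s, hs⟩ := Finsupp.ne_iff.1 hn
      have hle : Finsupp.single s 1 ≤ n := by
        rw [Finsupp.single_le_iff]
        exact Nat.one_le_iff_ne_zero.2 hs
      obtain ⟨n', rfl⟩ := exists_add_of_le hle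
      have hlt : n'.degree < N := by
        rw [← hN, map_add, Finsupp.degree_single]
        omega
      have hX : (MvPowerSeries.monomial (Finsupp.single s 1) (1 : K)) = MvPowerSeries.X s := rfl
      rw [monomial_add_eq_mul, hX, mul_assoc] at hab
      have hne := (prime_X (K := K) s).ne_zero
      rcases (prime_X (K := K) s).dvd_or_dvd (Dvd.intro _ hab.symm) with ⟨a', rfl⟩ | ⟨b', rfl⟩
      · rw [mul_assoc] at hab
        obtain ⟨m, v, hv, rfl⟩ := ih _ hlt n' a' b (mul_left_cancel₀ hne hab) rfl
        exact ⟨Finsupp.single s 1 + m, v, hv, by rw [monomial_add_eq_mul, hX, mul_assoc]⟩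
      · rw [mul_left_comm] at hab
        exact ih _ hlt n' a b' (mul_left_cancel₀ hne hab) rfl

/-! ### Fractional power series as Hahn series -/

section Frac

variable {K : Type*} [Field K] {d : ℕ}

theorem coeff_fracSeries (k : ℕ+) (φ : MvPowerSeries (Fin d) K) (n : Fin d →₀ ℕ) :
    (fracSeries K d k φ).coeff (divExp d k n) = MvPowerSeries.coeff n φ :=
  HahnSeries.embDomain_mk_coeff (divExp_injective d k) (divExp_le_iff d k)

theorem coeff_fracSeries_of_notMem (k : ℕ+) (φ : MvPowerSeries (Fin d) K) {q : Fin d → ℚ}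
    (hq : q ∉ Set.range (divExp d k)) : (fracSeries K d k φ).coeff q = 0 :=
  HahnSeries.embDomain_of_notMem_range hq

theorem fracSeries_injective (k : ℕ+) : Function.Injective (fracSeries K d k) := by
  intro φ ψ h
  ext n
  rw [← coeff_fracSeries k, h, coeff_fracSeries]

theorem mem_range_fracSeries {k : ℕ+} {Y : HahnSeries (Fin d → ℚ) K} :
    Y ∈ (fracSeries K d k).range ↔ Y.support ⊆ Set.range (divExp d k) := by
  constructor
  · rintro ⟨φ, rfl⟩ q hq
    by_contra hn
    exact hq (coeff_fracSeries_of_notMem k φ hn)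
  · intro h
    let φ : MvPowerSeries (Fin d) K := fun n => Y.coeff (divExp d k n)
    refine ⟨φ, ?_⟩
    ext q
    by_cases hq : q ∈ Set.range (divExp d k)
    · obtain ⟨n, rfl⟩ := hq
      rw [coeff_fracSeries]
      rfl
    · rw [coeff_fracSeries_of_notMem k φ hq]
      by_contra hne
      exact hq (h fun h0 => hne h0.symm)

theorem divExp_mul (k l : ℕ+) (n : Fin d →₀ ℕ) :
    divExp d (k * l) ((l : ℕ) • n) = divExp d k n := by
  funext i
  have hl : ((l : ℕ) : ℚ) ≠ 0 := by exact_mod_cast l.ne_zero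
  change (((l : ℕ) • n) i : ℕ) / (((k * l : ℕ+) : ℕ) : ℚ) = (n i : ℚ) / ((k : ℕ) : ℚ)
  rw [Finsupp.smul_apply, smul_eq_mul, PNat.mul_coe]
  push_cast
  rw [mul_comm, mul_div_mul_right _ _ hl]

theorem range_divExp_subset_mul (k l : ℕ+) :
    Set.range (divExp d k) ⊆ Set.range (divExp d (k * l)) := by
  rintro _ ⟨n, rfl⟩
  exact ⟨_, divExp_mul k l n⟩

theorem range_fracSeries_le_mul (k l : ℕ+) :
    (fracSeries K d k).range ≤ (fracSeries K d (k * l)).range := fun _ h =>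
  mem_range_fracSeries.2 ((mem_range_fracSeries.1 h).trans (range_divExp_subset_mul k l))

/-- The union of the rings `K[[X₁^{1/k},…,X_d^{1/k}]]`, `k ≥ 1`. -/
def fracRing (K : Type*) [Field K] (d : ℕ) : Subring (HahnSeries (Fin d → ℚ) K) where
  carrier := {Y | ∃ k : ℕ+, Y ∈ (fracSeries K d k).range}
  mul_mem' := by
    rintro a b ⟨k, ha⟩ ⟨l, hb⟩
    exact ⟨k * l, mul_mem (range_fracSeries_le_mul k l ha)
      (mul_comm l k ▸ range_fracSeries_le_mul l k hb)⟩
  add_mem' := by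
    rintro a b ⟨k, ha⟩ ⟨l, hb⟩
    exact ⟨k * l, add_mem (range_fracSeries_le_mul k l ha)
      (mul_comm l k ▸ range_fracSeries_le_mul l k hb)⟩
  one_mem' := ⟨1, one_mem _⟩
  zero_mem' := ⟨1, zero_mem _⟩
  neg_mem' := by
    rintro a ⟨k, ha⟩
    exact ⟨k, neg_mem ha⟩

theorem exists_common_denom {a b : HahnSeries (Fin d → ℚ) K} (ha : a ∈ fracRing K d)
    (hb : b ∈ fracRing K d) :
    ∃ k : ℕ+, a ∈ (fracSeries K d k).range ∧ b ∈ (fracSeries K d k).range := by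
  obtain ⟨k, ha⟩ := ha
  obtain ⟨l, hb⟩ := hb
  exact ⟨k * l, range_fracSeries_le_mul k l ha, mul_comm l k ▸ range_fracSeries_le_mul l k hb⟩

/-- Two elements have a common denominator, so a vanishing product already occurs in one power
series ring. Roots are counted in this domain. -/
instance : IsDomain (fracRing K d) := by
  have : NoZeroDivisors (fracRing K d) := by
    refine ⟨?_⟩
    rintro ⟨a, ha⟩ ⟨b, hb⟩ h
    have h' : a * b = 0 := congrArg Subtype.val h
    obtain ⟨k, ⟨φ, rfl⟩, ⟨ψ, rfl⟩⟩ := exists_common_denom ha hb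
    rw [← map_mul, map_eq_zero_iff _ (fracSeries_injective k), mul_eq_zero] at h'
    rcases h' with rfl | rfl
    · left
      exact Subtype.ext (map_zero _)
    · right
      exact Subtype.ext (map_zero _)
  exact NoZeroDivisors.to_isDomain _

/-- The inclusion of `K[[X₁,…,X_d]]` in the ring of fractional power series. -/
def toFrac (K : Type*) [Field K] (d : ℕ) : MvPowerSeries (Fin d) K →+* fracRing K d :=
  (fracSeries K d 1).codRestrict (fracRing K d) fun φ => ⟨1, φ, rfl⟩

theorem toFrac_injective : Function.Injective (toFrac K d) := fun _ _ h =>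
  fracSeries_injective 1 (congrArg Subtype.val h)

theorem mem_Zer_iff {f : Polynomial (MvPowerSeries (Fin d) K)} {Y : HahnSeries (Fin d → ℚ) K} :
    Y ∈ Zer f ↔ ∃ hY : Y ∈ fracRing K d, (f.map (toFrac K d)).eval ⟨Y, hY⟩ = 0 := by
  have key : ∀ hY : Y ∈ fracRing K d, (f.map (toFrac K d)).eval ⟨Y, hY⟩ = 0 ↔
      f.eval₂ (fracSeries K d 1) Y = 0 := by
    intro hY
    rw [Polynomial.eval_map, ← (Subtype.val_injective (p := (· ∈ fracRing K d))).eq_iff]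
    have := Polynomial.hom_eval₂ f (toFrac K d) (fracRing K d).subtype ⟨Y, hY⟩
    exact Eq.congr_left this
  constructor
  · rintro ⟨h1, h2⟩
    exact ⟨h1, (key h1).2 h2⟩
  · rintro ⟨h1, h2⟩
    exact ⟨h1, (key h1).1 h2⟩

theorem fracSeries_monomial (k : ℕ+) (n : Fin d →₀ ℕ) (a : K) :
    fracSeries K d k (MvPowerSeries.monomial n a) = HahnSeries.single (divExp d k n) a := by
  classical
  ext q
  by_cases hq : q ∈ Set.range (divExp d k)
  · obtain ⟨m, rfl⟩ := hq
    rw [coeff_fracSeries, MvPowerSeries.coeff_monomial, HahnSeries.coeff_single]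
    simp [(divExp_injective d k).eq_iff]
  · rw [coeff_fracSeries_of_notMem k _ hq, HahnSeries.coeff_single_of_ne]
    rintro rfl
    exact hq ⟨n, rfl⟩

theorem coeff_zero_fracSeries (k : ℕ+) (φ : MvPowerSeries (Fin d) K) :
    (fracSeries K d k φ).coeff 0 = MvPowerSeries.constantCoeff φ := by
  rw [← map_zero (divExp d k), coeff_fracSeries, MvPowerSeries.coeff_zero_eq_constantCoeff]

theorem fracSeries_one_monomial_mul (k : ℕ+) (n : Fin d →₀ ℕ) (u : MvPowerSeries (Fin d) K) :
    ∃ u' : MvPowerSeries (Fin d) K,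
      MvPowerSeries.constantCoeff u' = MvPowerSeries.constantCoeff u ∧
      fracSeries K d 1 (MvPowerSeries.monomial n 1 * u) =
        fracSeries K d k (MvPowerSeries.monomial ((k : ℕ) • n) 1 * u') := by
  obtain ⟨u', hu'⟩ : fracSeries K d 1 u ∈ (fracSeries K d k).range := by
    have := range_fracSeries_le_mul (K := K) (d := d) 1 k ⟨u, rfl⟩
    rwa [one_mul] at this
  refine ⟨u', ?_, ?_⟩
  · rw [← coeff_zero_fracSeries k, hu', coeff_zero_fracSeries]
  · rw [map_mul, map_mul, hu', fracSeries_monomial, fracSeries_monomial]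
    congr 2
    rw [← divExp_mul 1 k n, one_mul]

/-! ### Contacts of the roots of a quasi-ordinary polynomial -/

/-- With `p = (X - x) q` one has `q(y) = 0`, so `p'(x) = q(x) - q(y)` is divisible by `x - y`. Up to
sign the discriminant is a combination of `p` and `p'`; evaluating at `x` leaves a multiple of
`p'(x)`. No splitting of `p` is needed. -/
theorem sub_dvd_discr {R : Type*} [CommRing R] [IsDomain R] {S : Type*} [CommRing S] (ι : S →+* R)
    {p : Polynomial S} (hp : p.Monic) {x y : R} (hx : (p.map ι).eval x = 0)
    (hy : (p.map ι).eval y = 0) (hxy : x ≠ y) : x - y ∣ ι p.discr := by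
  have hpm := hp.map ι
  have hnt : Nontrivial S := by
    have := ι.domain_nontrivial
    exact this
  have hdeg : 0 < p.natDegree := by
    rw [← hp.natDegree_map ι]
    rw [Nat.pos_iff_ne_zero]
    intro h0
    rw [Polynomial.eq_one_of_monic_natDegree_zero hpm h0] at hx
    simp at hx
  obtain ⟨q, hq⟩ := Polynomial.dvd_iff_isRoot.2 hx
  have hqy : q.eval y = 0 := by
    rw [hq, Polynomial.eval_mul] at hy
    refine (mul_eq_zero.1 hy).resolve_left ?_
    simpa [sub_eq_zero] using hxy.symm
  have h1 : x - y ∣ (p.derivative.map ι).eval x := by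
    have h2 : (p.derivative.map ι).eval x = q.eval x - q.eval y := by
      rw [hqy, sub_zero, ← Polynomial.derivative_map, hq]
      simp
    rw [h2]
    exact Polynomial.sub_dvd_eval_sub x y q
  obtain ⟨a, b, -, -, hab⟩ := Polynomial.exists_mul_add_mul_eq_C_resultant p p.derivative
    (m := p.natDegree) (n := p.natDegree - 1) le_rfl (Polynomial.natDegree_derivative_le p)
    (Or.inl hdeg.ne')
  rw [Polynomial.resultant_deriv (Polynomial.natDegree_pos_iff_degree_pos.1 hdeg), hp.leadingCoeff,
    mul_one] at hab
  have h3 := congrArg (fun r => (r.map ι).eval x) hab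
  simp only [Polynomial.map_add, Polynomial.map_mul, Polynomial.eval_add, Polynomial.eval_mul, hx,
    zero_mul, zero_add, Polynomial.map_C, Polynomial.eval_C, map_mul] at h3
  have h4 := h1.trans (Dvd.intro _ h3)
  rcases neg_one_pow_eq_or S (p.natDegree * (p.natDegree - 1) / 2) with h5 | h5
  · rw [h5] at h4
    simpa using h4
  · rw [h5] at h4
    simpa using h4

theorem exists_hasContact {p : Polynomial (MvPowerSeries (Fin d) K)} (hm : p.Monic)
    (hQ : IsQuasiOrdinary p) {Y Y' : HahnSeries (Fin d → ℚ) K} (hY : Y ∈ Zer p) (hY' : Y' ∈ Zer p) :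
    ∃ c, HasContact Y Y' c := by
  by_cases hne : Y = Y'
  · exact ⟨⊤, Or.inl ⟨hne, rfl⟩⟩
  obtain ⟨hYm, hY0⟩ := mem_Zer_iff.1 hY
  obtain ⟨hYm', hY0'⟩ := mem_Zer_iff.1 hY'
  obtain ⟨⟨b, hb⟩, hab⟩ := sub_dvd_discr (toFrac K d) hm hY0 hY0'
    (fun h => hne (congrArg Subtype.val h))
  obtain ⟨α, u, hu, hd⟩ := hQ
  -- One denominator for the difference and its cofactor turns the divisibility into a factorization
  -- in a single power series ring.
  obtain ⟨k, ⟨a', ha'⟩, ⟨b', rfl⟩⟩ := exists_common_denom (sub_mem hYm hYm') hb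
  have hab' : fracSeries K d 1 p.discr = (Y - Y') * fracSeries K d k b' := congrArg Subtype.val hab
  obtain ⟨u', hu', hk⟩ := fracSeries_one_monomial_mul k α u
  rw [hd, hk, ← ha', ← map_mul] at hab'
  obtain ⟨m, v, hv, rfl⟩ := exists_eq_monomial_mul_of_mul_eq _ a' b' u' (hu' ▸ hu)
    (fracSeries_injective k hab'.symm)
  exact ⟨_, Or.inr ⟨k, m, v, hv, ha'.symm, rfl⟩⟩

end Frac

/-! ### Characters -/

section Characters

variable {K : Type*} [Field K]

/-- Roots of all orders exist in `K`, so `Kˣ` is divisible, hence injective as an abelian group;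
this is what extends characters from subgroups. -/
theorem baer_units [IsAlgClosed K] : Module.Baer ℤ (Additive Kˣ) := by
  have hsurj : ∀ {n : ℕ}, n ≠ 0 → Function.Surjective (fun a : Additive Kˣ => n • a) := by
    intro n hn a
    obtain ⟨z, hz⟩ := IsAlgClosed.exists_pow_nat_eq ((a.toMul : Kˣ) : K) (Nat.pos_of_ne_zero hn)
    have hz0 : z ≠ 0 := by
      rintro rfl
      rw [zero_pow hn] at hz
      exact (a.toMul).ne_zero hz.symm
    refine ⟨Additive.ofMul (Units.mk0 z hz0), ?_⟩
    apply Additive.toMul.injective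
    apply Units.ext
    simpa using hz
  let _ : DivisibleBy (Additive Kˣ) ℕ := divisibleByOfSMulRightSurj _ _ hsurj
  let _ : DivisibleBy (Additive Kˣ) ℤ := AddGroup.divisibleByIntOfDivisibleByNat _
  exact Module.Baer.of_divisible _

/-- If `a` has order `r` modulo `N`, every `r`-th root of unity is the value at `a` of a character
that is trivial on `N`. -/
theorem exists_character [IsAlgClosed K] {A : Type*} [AddCommGroup A] (N : AddSubgroup A) (a : A)
    (ζ : Kˣ) (hζ : ζ ^ addOrderOf (a : A ⧸ N) = 1) :
    ∃ χ : A →+ Additive Kˣ, (∀ x ∈ N, χ x = 0) ∧ χ a = Additive.ofMul ζ := by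
  set r := addOrderOf (a : A ⧸ N) with hr
  -- `φ` embeds `ZMod r` as the cyclic group generated by the class of `a`, and `ψ` sends `1` to
  -- `ζ`. The character extends `ψ` along `φ`.
  let φ : ZMod r →+ A ⧸ N := ZMod.lift r ⟨zmultiplesHom _ (a : A ⧸ N), by
    simp only [zmultiplesHom_apply, natCast_zsmul]
    exact addOrderOf_nsmul_eq_zero _⟩
  let ψ : ZMod r →+ Additive Kˣ := ZMod.lift r ⟨zmultiplesHom _ (Additive.ofMul ζ), by
    simp only [zmultiplesHom_apply, natCast_zsmul]
    rw [← ofMul_pow, hζ, ofMul_one]⟩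
  have hφ : Function.Injective φ := by
    rw [ZMod.lift_injective]
    intro m hm
    rw [ZMod.intCast_zmod_eq_zero_iff_dvd, hr, addOrderOf_dvd_iff_zsmul_eq_zero]
    exact hm
  obtain ⟨χ, hχ⟩ := (baer_units (K := K)).extension_property_addMonoidHom φ hφ ψ
  refine ⟨χ.comp (QuotientAddGroup.mk' N), fun x hx => ?_, ?_⟩
  · have : (QuotientAddGroup.mk' N) x = 0 := (QuotientAddGroup.eq_zero_iff x).2 hx
    rw [AddMonoidHom.comp_apply, this, map_zero]
  · have h1 : φ ((1 : ℤ) : ZMod r) = (a : A ⧸ N) := by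
      rw [ZMod.lift_coe]
      simp
    have h2 : ψ ((1 : ℤ) : ZMod r) = Additive.ofMul ζ := by
      rw [ZMod.lift_coe]
      simp
    rw [AddMonoidHom.comp_apply, QuotientAddGroup.mk'_apply, ← h1, ← h2, ← hχ]
    rfl

/-- The value of a character as an element of the field. -/
def charVal {A : Type*} [AddCommGroup A] (χ : A →+ Additive Kˣ) (a : A) : K := ((χ a).toMul : Kˣ)

theorem charVal_ne_zero {A : Type*} [AddCommGroup A] (χ : A →+ Additive Kˣ) (a : A) :
    charVal χ a ≠ 0 := Units.ne_zero _

theorem charVal_eq_one_iff {A : Type*} [AddCommGroup A] {χ : A →+ Additive Kˣ} {a : A} :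
    charVal χ a = 1 ↔ χ a = 0 := by
  rw [charVal, Units.val_eq_one]
  rfl

theorem charVal_add {A : Type*} [AddCommGroup A] (χ : A →+ Additive Kˣ) (a b : A) :
    charVal χ (a + b) = charVal χ a * charVal χ b := by
  simp [charVal]

theorem charVal_add_left {A : Type*} [AddCommGroup A] (χ ψ : A →+ Additive Kˣ) (a : A) :
    charVal (χ + ψ) a = charVal χ a * charVal ψ a := by
  simp [charVal]

end Characters

/-! ### The action of characters on fractional power series -/

section Twist

variable {K : Type*} [Field K] {d : ℕ}

/-- The action of a character of `ℚ^d` on series: `X^q` is sent to `χ(q) X^q`. -/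
def twist (χ : (Fin d → ℚ) →+ Additive Kˣ) :
    HahnSeries (Fin d → ℚ) K →+* HahnSeries (Fin d → ℚ) K where
  toFun Y := ⟨fun q => charVal χ q * Y.coeff q,
    Y.isPWO_support.mono fun _ hq => right_ne_zero_of_mul hq⟩
  map_one' := by
    classical
    ext q
    simp only [HahnSeries.coeff_one]
    split_ifs with hq
    · rw [hq, mul_one, charVal_eq_one_iff, map_zero]
    · rw [mul_zero]
  map_zero' := by
    ext q
    simp
  map_add' Y Z := by
    ext q
    simp [mul_add]
  map_mul' Y Z := by
    ext q
    -- Twisting does not change supports, so both sides are sums over the same pairs of exponents.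
    have h1 : ∀ W : HahnSeries (Fin d → ℚ) K, ∀ h,
        (⟨fun q => charVal χ q * W.coeff q, h⟩ : HahnSeries (Fin d → ℚ) K).support ⊆ W.support :=
      fun W h _ hq => right_ne_zero_of_mul hq
    rw [HahnSeries.coeff_mul_left' Y.isPWO_support (h1 Y _)]
    have h2 : ∀ W : HahnSeries (Fin d → ℚ) K, ∀ h,
        (⟨fun q => charVal χ q * W.coeff q, h⟩ : HahnSeries (Fin d → ℚ) K).support = W.support :=
      fun W h => subset_antisymm (h1 W h) fun q hq => mul_ne_zero (charVal_ne_zero _ _) hq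
    simp only [h2, HahnSeries.coeff_mul, Finset.mul_sum]
    refine Finset.sum_congr rfl fun x hx => ?_
    rw [Finset.mem_antidiagonal] at hx
    rw [← hx.2.2, charVal_add]
    ring

theorem coeff_twist (χ : (Fin d → ℚ) →+ Additive Kˣ) (Y : HahnSeries (Fin d → ℚ) K)
    (q : Fin d → ℚ) : (twist χ Y).coeff q = charVal χ q * Y.coeff q := rfl

theorem support_twist (χ : (Fin d → ℚ) →+ Additive Kˣ) (Y : HahnSeries (Fin d → ℚ) K) :
    (twist χ Y).support = Y.support := by
  ext q
  simp [coeff_twist, charVal_ne_zero]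

theorem twist_injective (χ : (Fin d → ℚ) →+ Additive Kˣ) :
    Function.Injective (twist (K := K) χ) := by
  rw [injective_iff_map_eq_zero]
  intro Y hY
  rw [← HahnSeries.support_eq_empty_iff] at hY ⊢
  rwa [support_twist] at hY

theorem twist_add (χ ψ : (Fin d → ℚ) →+ Additive Kˣ) (Y : HahnSeries (Fin d → ℚ) K) :
    twist (χ + ψ) Y = twist χ (twist ψ Y) := by
  ext q
  rw [coeff_twist, coeff_twist, coeff_twist, charVal_add_left, mul_assoc]

theorem twist_mem_fracRing (χ : (Fin d → ℚ) →+ Additive Kˣ) {Y : HahnSeries (Fin d → ℚ) K}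
    (hY : Y ∈ fracRing K d) : twist χ Y ∈ fracRing K d := by
  obtain ⟨k, hk⟩ := hY
  refine ⟨k, ?_⟩
  rw [mem_range_fracSeries] at hk ⊢
  rwa [support_twist]

/-- The restriction of `twist χ` to the ring of fractional power series. -/
def twistFrac (χ : (Fin d → ℚ) →+ Additive Kˣ) : fracRing K d →+* fracRing K d :=
  (twist χ).restrict _ _ fun _ => twist_mem_fracRing χ

theorem coe_twistFrac (χ : (Fin d → ℚ) →+ Additive Kˣ) (Y : fracRing K d) :
    (twistFrac χ Y : HahnSeries (Fin d → ℚ) K) = twist χ Y := rfl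

theorem twistFrac_injective (χ : (Fin d → ℚ) →+ Additive Kˣ) :
    Function.Injective (twistFrac (K := K) χ) := fun _ _ h =>
  Subtype.ext (twist_injective χ (congrArg Subtype.val h))

/-- The lattice `ℤ^d` in `ℚ^d`. -/
def intLattice (d : ℕ) : AddSubgroup (Fin d → ℚ) :=
  ((Int.castAddHom ℚ).compLeft (Fin d)).range

theorem mem_intLattice {v : Fin d → ℚ} :
    v ∈ intLattice d ↔ ∃ m : Fin d → ℤ, v = fun l => (m l : ℚ) :=
  ⟨fun ⟨m, hm⟩ => ⟨m, hm.symm⟩, fun ⟨m, hm⟩ => ⟨m, hm.symm⟩⟩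

theorem divExp_one_mem_intLattice (n : Fin d →₀ ℕ) : divExp d 1 n ∈ intLattice d := by
  refine mem_intLattice.2 ⟨fun l => n l, ?_⟩
  funext l
  simp [divExp]

theorem nsmul_divExp_mem_intLattice (k : ℕ+) (n : Fin d →₀ ℕ) :
    (k : ℕ) • divExp d k n ∈ intLattice d := by
  refine mem_intLattice.2 ⟨fun l => n l, ?_⟩
  funext l
  have hk : ((k : ℕ) : ℚ) ≠ 0 := by exact_mod_cast k.ne_zero
  change (k : ℕ) • ((n l : ℚ) / ((k : ℕ) : ℚ)) = ((n l : ℤ) : ℚ)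
  rw [nsmul_eq_mul, mul_div_cancel₀ _ hk, Int.cast_natCast]

theorem divExp_mem_range_one {k : ℕ+} {n : Fin d →₀ ℕ} (h : divExp d k n ∈ intLattice d) :
    divExp d k n ∈ Set.range (divExp d 1) := by
  obtain ⟨m, hm⟩ := mem_intLattice.1 h
  have hm0 : ∀ l, 0 ≤ m l := by
    intro l
    have h1 := congrFun hm l
    have h2 : (0 : ℚ) ≤ divExp d k n l := div_nonneg (Nat.cast_nonneg _) (Nat.cast_nonneg _)
    rw [h1] at h2
    exact_mod_cast h2
  refine ⟨Finsupp.equivFunOnFinite.symm fun l => (m l).toNat, ?_⟩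
  rw [hm]
  funext l
  change (((m l).toNat : ℕ) : ℚ) / ((1 : ℕ+) : ℕ) = _
  rw [PNat.one_coe, Nat.cast_one, div_one]
  exact_mod_cast congrArg (Int.cast : ℤ → ℚ) (Int.toNat_of_nonneg (hm0 l))

theorem twist_fracSeries_one {χ : (Fin d → ℚ) →+ Additive Kˣ} (hχ : ∀ v ∈ intLattice d, χ v = 0)
    (φ : MvPowerSeries (Fin d) K) : twist χ (fracSeries K d 1 φ) = fracSeries K d 1 φ := by
  ext q
  rw [coeff_twist]
  by_cases hq : q ∈ Set.range (divExp d 1)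
  · obtain ⟨n, rfl⟩ := hq
    rw [charVal_eq_one_iff.2 (hχ _ (divExp_one_mem_intLattice n)), one_mul]
  · rw [coeff_fracSeries_of_notMem 1 φ hq, mul_zero]

theorem addOrderOf_pos_of_nsmul_mem {A : Type*} [AddCommGroup A] {N : AddSubgroup A} {a : A}
    (k : ℕ+) (h : (k : ℕ) • a ∈ N) : 0 < addOrderOf (a : A ⧸ N) := by
  rw [addOrderOf_pos_iff, isOfFinAddOrder_iff_nsmul_eq_zero]
  exact ⟨k, k.pos, (QuotientAddGroup.eq_zero_iff _).2 h⟩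

theorem twistFrac_toFrac {χ : (Fin d → ℚ) →+ Additive Kˣ} (hχ : ∀ v ∈ intLattice d, χ v = 0)
    (φ : MvPowerSeries (Fin d) K) : twistFrac χ (toFrac K d φ) = toFrac K d φ :=
  Subtype.ext (twist_fracSeries_one hχ φ)

theorem eval_twistFrac {χ : (Fin d → ℚ) →+ Additive Kˣ} (hχ : ∀ v ∈ intLattice d, χ v = 0)
    (f : Polynomial (MvPowerSeries (Fin d) K)) (y : fracRing K d) :
    (f.map (toFrac K d)).eval (twistFrac χ y) = twistFrac χ ((f.map (toFrac K d)).eval y) := by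
  have h1 : (f.map (toFrac K d)).map (twistFrac χ) = f.map (toFrac K d) := by
    rw [Polynomial.map_map]
    congr 1
    ext1 φ
    exact twistFrac_toFrac hχ φ
  conv_lhs => rw [← h1]
  rw [Polynomial.eval_map_apply]

theorem twist_mem_Zer {χ : (Fin d → ℚ) →+ Additive Kˣ} (hχ : ∀ v ∈ intLattice d, χ v = 0)
    {f : Polynomial (MvPowerSeries (Fin d) K)} {Y : HahnSeries (Fin d → ℚ) K} (hY : Y ∈ Zer f) :
    twist χ Y ∈ Zer f := by
  obtain ⟨hm, h0⟩ := mem_Zer_iff.1 hY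
  refine mem_Zer_iff.2 ⟨twist_mem_fracRing χ hm, ?_⟩
  have := eval_twistFrac hχ f ⟨Y, hm⟩
  rw [h0, map_zero] at this
  exact this

variable [IsAlgClosed K] [CharZero K]

theorem exists_isPrimitiveRoot_units (r : ℕ) (hr : 0 < r) : ∃ ζ : Kˣ, IsPrimitiveRoot ζ r := by
  have : NeZero r := ⟨hr.ne'⟩
  have : NeZero (r : K) := ⟨Nat.cast_ne_zero.2 hr.ne'⟩
  obtain ⟨ζ, hζ⟩ := HasEnoughRootsOfUnity.exists_primitiveRoot K r
  exact ⟨_, hζ.isUnit_unit hr.ne'⟩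

/-- An exponent `q` in the support has finite order `r` modulo `ℤ^d`, and some admissible character
takes a primitive `r`-th root of unity as its value at `q`. Invariance forces this value to be `1`,
so `r = 1` and `q` is integral. -/
theorem mem_range_of_twist_eq {Y : HahnSeries (Fin d → ℚ) K} (hY : Y ∈ fracRing K d)
    (h : ∀ χ : (Fin d → ℚ) →+ Additive Kˣ, (∀ v ∈ intLattice d, χ v = 0) → twist χ Y = Y) :
    Y ∈ (fracSeries K d 1).range := by
  obtain ⟨k, hk⟩ := hY
  rw [mem_range_fracSeries] at hk ⊢
  intro q hq
  obtain ⟨n, rfl⟩ := hk hq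
  refine divExp_mem_range_one ?_
  have hr := addOrderOf_pos_of_nsmul_mem k (nsmul_divExp_mem_intLattice k n)
  obtain ⟨ζ, hζ⟩ := exists_isPrimitiveRoot_units (K := K) _ hr
  obtain ⟨χ, hχ, hχa⟩ := exists_character (intLattice d) (divExp d k n) ζ hζ.pow_eq_one
  have h1 := congrArg (fun Z => HahnSeries.coeff Z (divExp d k n)) (h χ hχ)
  simp only [coeff_twist] at h1
  have h2 := charVal_eq_one_iff.1 (mul_eq_right₀ hq |>.1 h1)
  rw [hχa] at h2
  have h3 : ζ = 1 := h2
  rw [← QuotientAddGroup.eq_zero_iff, ← AddMonoid.addOrderOf_eq_one_iff]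
  exact hζ.eq_orderOf.trans (by rw [h3, orderOf_one])

/-- The roots of an irreducible polynomial are conjugate. -/
theorem exists_twist_eq {f : Polynomial (MvPowerSeries (Fin d) K)} (hm : f.Monic)
    (hirr : Irreducible f) {Y Y' : HahnSeries (Fin d → ℚ) K} (hY : Y ∈ Zer f) (hY' : Y' ∈ Zer f) :
    ∃ χ : (Fin d → ℚ) →+ Additive Kˣ, (∀ v ∈ intLattice d, χ v = 0) ∧ twist χ Y = Y' := by
  classical
  obtain ⟨hYm, hY0⟩ := mem_Zer_iff.1 hY
  obtain ⟨hYm', hY0'⟩ := mem_Zer_iff.1 hY'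
  set F := f.map (toFrac K d) with hF
  have hFm : F.Monic := hm.map _
  set y : fracRing K d := ⟨Y, hYm⟩ with hy
  -- The orbit of `y`; it is finite because conjugates of a root are roots.
  let S : Finset (fracRing K d) := F.roots.toFinset.filter fun s =>
    ∃ χ : (Fin d → ℚ) →+ Additive Kˣ, (∀ v ∈ intLattice d, χ v = 0) ∧ s = twistFrac χ y
  have hS : ∀ s, s ∈ S ↔ ∃ χ : (Fin d → ℚ) →+ Additive Kˣ,
      (∀ v ∈ intLattice d, χ v = 0) ∧ s = twistFrac χ y := by
    intro s
    rw [Finset.mem_filter, Multiset.mem_toFinset, Polynomial.mem_roots hFm.ne_zero,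
      and_iff_right_iff_imp]
    rintro ⟨χ, hχ, rfl⟩
    rw [Polynomial.IsRoot, eval_twistFrac hχ, hY0, map_zero]
  have hyS : y ∈ S := by
    refine (hS y).2 ⟨0, fun _ _ => rfl, Subtype.ext ?_⟩
    ext q
    rw [coe_twistFrac, coeff_twist, charVal_eq_one_iff.2 rfl, one_mul]
  let P : Polynomial (fracRing K d) := ∏ s ∈ S, (Polynomial.X - Polynomial.C s)
  have hPm : P.Monic := Polynomial.monic_prod_of_monic _ _ fun s _ => Polynomial.monic_X_sub_C s
  have hPinv : ∀ χ : (Fin d → ℚ) →+ Additive Kˣ, (∀ v ∈ intLattice d, χ v = 0) →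
      P.map (twistFrac χ) = P := by
    intro χ hχ
    have hSi : S.image (twistFrac χ) = S := by
      refine Finset.eq_of_subset_of_card_le ?_
        (Finset.card_image_of_injective _ (twistFrac_injective χ)).ge
      intro s hs
      obtain ⟨t, ht, rfl⟩ := Finset.mem_image.1 hs
      obtain ⟨ψ, hψ, rfl⟩ := (hS t).1 ht
      refine (hS _).2 ⟨χ + ψ, fun v hv => ?_, Subtype.ext (twist_add χ ψ Y).symm⟩
      rw [AddMonoidHom.add_apply, hχ v hv, hψ v hv, add_zero]
    have h1 : P = ∏ s ∈ S.image (twistFrac χ), (Polynomial.X - Polynomial.C s) := by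
      rw [hSi]
    rw [Finset.prod_image fun a _ b _ h => twistFrac_injective χ h] at h1
    rw [h1, Polynomial.map_prod]
    simp only [Polynomial.map_sub, Polynomial.map_X, Polynomial.map_C]
    rw [← Finset.prod_image (s := S) (g := twistFrac χ)
      (f := fun s => Polynomial.X - Polynomial.C (twistFrac χ s))
      fun a _ b _ h => twistFrac_injective χ h, hSi]
  -- The action permutes the orbit, so the coefficients of `P` are invariant and come from `K[[X]]`.
  have hlift : P ∈ Polynomial.lifts (toFrac K d) := by
    rw [Polynomial.lifts_iff_coeff_lifts]
    intro n
    obtain ⟨φ, hφ⟩ := mem_range_of_twist_eq (P.coeff n).2 fun χ hχ => by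
      conv_rhs => rw [← hPinv χ hχ, Polynomial.coeff_map]
      rfl
    exact ⟨φ, Subtype.ext hφ⟩
  obtain ⟨p, hpP, -, hpm⟩ := Polynomial.lifts_and_natDegree_eq_and_monic hlift hPm
  have hPF : P ∣ F := by
    have h1 : P = (S.val.map fun a => Polynomial.X - Polynomial.C a).prod := rfl
    rw [h1, Multiset.prod_X_sub_C_dvd_iff_le_roots hFm.ne_zero, Multiset.le_iff_subset S.nodup]
    intro s hs
    exact Multiset.mem_toFinset.1 (Finset.mem_filter.1 hs).1
  have hpf : p ∣ f := by
    rw [← Polynomial.map_dvd_map (toFrac K d) toFrac_injective hpm, hpP]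
    exact hPF
  obtain ⟨q, rfl⟩ := hpf
  -- The factor `p` vanishes at `y`, so it is not a unit. The cofactor is then a unit and cannot
  -- vanish at `Y'`, so `Y'` lies in the orbit.
  rcases hirr.isUnit_or_isUnit rfl with h | h
  · exfalso
    rw [hpm.eq_one_of_isUnit h, Polynomial.map_one] at hpP
    have h2 : P.eval y = 0 := by
      rw [Polynomial.eval_prod]
      exact Finset.prod_eq_zero hyS (by simp)
    rw [← hpP, Polynomial.eval_one] at h2
    exact one_ne_zero h2
  · rw [hF, Polynomial.map_mul, Polynomial.eval_mul, hpP] at hY0'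
    have hu : IsUnit ((q.map (toFrac K d)).eval ⟨Y', hYm'⟩) :=
      (h.map (Polynomial.mapRingHom (toFrac K d))).map (Polynomial.evalRingHom _)
    have h3 := (mul_eq_zero.1 hY0').resolve_right hu.ne_zero
    rw [Polynomial.eval_prod, Finset.prod_eq_zero_iff] at h3
    obtain ⟨s, hs, hs0⟩ := h3
    rw [Polynomial.eval_sub, Polynomial.eval_X, Polynomial.eval_C, sub_eq_zero] at hs0
    obtain ⟨χ, hχ, hχs⟩ := (hS s).1 hs
    exact ⟨χ, hχ, congrArg Subtype.val (hχs.symm.trans hs0.symm)⟩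

end Twist

/-! ### Contacts -/

section Contact

variable {K : Type*} [Field K] {d : ℕ}

theorem HasContact.symm {x y : HahnSeries (Fin d → ℚ) K} {c : WithTop (Fin d → ℚ)}
    (h : HasContact x y c) : HasContact y x c := by
  rcases h with ⟨rfl, rfl⟩ | ⟨k, n, u, hu, h, rfl⟩
  · exact Or.inl ⟨rfl, rfl⟩
  · refine Or.inr ⟨k, n, -u, by simpa using hu, ?_, rfl⟩
    rw [mul_neg, map_neg, ← h, neg_sub]

/-- All exponents of a monomial times a series dominate that of the monomial, which itself occurs
because the series has non-zero constant term. Contacts can thus be read off from coefficients. -/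
theorem HasContact.isLeast {x y : HahnSeries (Fin d → ℚ) K} {q : Fin d → ℚ}
    (h : HasContact x y q) : IsLeast (x - y).support q := by
  classical
  rcases h with ⟨-, h⟩ | ⟨k, n, u, hu, h, hq⟩
  · exact absurd h (WithTop.coe_ne_top)
  · rw [WithTop.coe_inj] at hq
    subst hq
    rw [h]
    constructor
    · rw [HahnSeries.mem_support, coeff_fracSeries, MvPowerSeries.coeff_monomial_mul,
        if_pos le_rfl, one_mul, tsub_self, MvPowerSeries.coeff_zero_eq_constantCoeff]
      exact hu
    · intro q hq
      obtain ⟨m, rfl⟩ := mem_range_fracSeries.1 ⟨_, rfl⟩ hq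
      rw [HahnSeries.mem_support, coeff_fracSeries, MvPowerSeries.coeff_monomial_mul] at hq
      rw [divExp_le_iff]
      by_contra hle
      rw [if_neg hle] at hq
      exact hq rfl

theorem HasContact.eq_of_top {x y : HahnSeries (Fin d → ℚ) K} (h : HasContact x y ⊤) : x = y := by
  rcases h with ⟨h, -⟩ | ⟨k, n, u, hu, h, hq⟩
  · exact h
  · exact absurd hq.symm WithTop.coe_ne_top

theorem HasContact.unique {x y : HahnSeries (Fin d → ℚ) K} {c c' : WithTop (Fin d → ℚ)}
    (h : HasContact x y c) (h' : HasContact x y c') : c = c' := by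
  have key : ∀ q : Fin d → ℚ, ¬ HasContact x x q := by
    intro q hq
    have := hq.isLeast.1
    simp at this
  induction c with
  | top =>
    induction c' with
    | top => rfl
    | coe q =>
      rw [h.eq_of_top] at h'
      exact absurd h' (h.eq_of_top ▸ key q)
  | coe p =>
    induction c' with
    | top =>
      rw [h'.eq_of_top] at h
      exact absurd h (h'.eq_of_top ▸ key p)
    | coe q => rw [h.isLeast.unique h'.isLeast]

open Classical in
/-- The contact of two series, with the value `∞` if it is not defined. -/
def contact (x y : HahnSeries (Fin d → ℚ) K) : WithTop (Fin d → ℚ) :=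
  if h : ∃ c, HasContact x y c then h.choose else ⊤

/-- Any two elements of `Z` have a contact. -/
def HasContacts (Z : Set (HahnSeries (Fin d → ℚ) K)) : Prop :=
  ∀ x ∈ Z, ∀ y ∈ Z, ∃ c, HasContact x y c

theorem HasContact.contact_eq {x y : HahnSeries (Fin d → ℚ) K} {c : WithTop (Fin d → ℚ)}
    (h : HasContact x y c) : contact x y = c := by
  have h' : ∃ c, HasContact x y c := ⟨c, h⟩
  rw [contact, dif_pos h']
  exact h'.choose_spec.unique h

@[simp]
theorem contact_self (x : HahnSeries (Fin d → ℚ) K) : contact x x = ⊤ :=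
  HasContact.contact_eq (Or.inl ⟨rfl, rfl⟩)

variable {Z : Set (HahnSeries (Fin d → ℚ) K)} {x y z : HahnSeries (Fin d → ℚ) K}

theorem HasContacts.mono {B : Set (HahnSeries (Fin d → ℚ) K)} (hZ : HasContacts Z) (h : B ⊆ Z) :
    HasContacts B := fun x hx y hy => hZ x (h hx) y (h hy)

theorem HasContacts.hasContact (hZ : HasContacts Z) (hx : x ∈ Z) (hy : y ∈ Z) :
    HasContact x y (contact x y) := by
  obtain ⟨c, hc⟩ := hZ x hx y hy
  rwa [hc.contact_eq]

theorem HasContacts.hasContact_iff (hZ : HasContacts Z) (hx : x ∈ Z) (hy : y ∈ Z)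
    {c : WithTop (Fin d → ℚ)} : HasContact x y c ↔ contact x y = c :=
  ⟨fun h => h.contact_eq, fun h => h ▸ hZ.hasContact hx hy⟩

theorem HasContacts.comm (hZ : HasContacts Z) (hx : x ∈ Z) (hy : y ∈ Z) :
    contact x y = contact y x :=
  ((hZ.hasContact hx hy).symm.contact_eq).symm

theorem HasContacts.eq_of_top_le (hZ : HasContacts Z) (hx : x ∈ Z) (hy : y ∈ Z)
    (h : ⊤ ≤ contact x y) : x = y :=
  HasContact.eq_of_top (top_le_iff.1 h ▸ hZ.hasContact hx hy)

theorem HasContacts.contact_le (hZ : HasContacts Z) (hx : x ∈ Z) (hy : y ∈ Z) {q : Fin d → ℚ}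
    (h : x.coeff q ≠ y.coeff q) : contact x y ≤ q := by
  have hc := hZ.hasContact hx hy
  generalize contact x y = c at hc
  induction c with
  | top => exact absurd (by rw [hc.eq_of_top]) h
  | coe p =>
    refine WithTop.coe_le_coe.2 (hc.isLeast.2 ?_)
    rw [HahnSeries.mem_support, HahnSeries.coeff_sub]
    exact sub_ne_zero.2 h

theorem HasContacts.coeff_ne (hZ : HasContacts Z) (hx : x ∈ Z) (hy : y ∈ Z) {q : Fin d → ℚ}
    (h : contact x y = q) : x.coeff q ≠ y.coeff q := by
  have hc := (hZ.hasContact_iff hx hy).2 h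
  have := hc.isLeast.1
  rw [HahnSeries.mem_support, HahnSeries.coeff_sub] at this
  exact sub_ne_zero.1 this

/-- The ultrametric inequality, as a disjunction because exponents are only partially ordered. At
the exponent `contact x z` the coefficients of `x` and `z` differ, so that of `y` differs from one
of them. -/
theorem HasContacts.contact_le_or (hZ : HasContacts Z) (hx : x ∈ Z) (hy : y ∈ Z) (hz : z ∈ Z) :
    contact x y ≤ contact x z ∨ contact y z ≤ contact x z := by
  by_cases htop : contact x z = ⊤
  · rw [htop]
    exact Or.inl le_top
  · obtain ⟨q, hq⟩ := WithTop.ne_top_iff_exists.1 htop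
    have hne := hZ.coeff_ne hx hz hq.symm
    rw [← hq]
    by_cases h : x.coeff q = y.coeff q
    · right
      exact hZ.contact_le hy hz (h ▸ hne)
    · left
      exact hZ.contact_le hx hy h

theorem HasContacts.le_trans (hZ : HasContacts Z) (hx : x ∈ Z) (hy : y ∈ Z) (hz : z ∈ Z)
    {c : WithTop (Fin d → ℚ)} (h₁ : c ≤ contact x y) (h₂ : c ≤ contact y z) : c ≤ contact x z :=
  (hZ.contact_le_or hx hy hz).elim h₁.trans h₂.trans

theorem HasContacts.lt_trans (hZ : HasContacts Z) (hx : x ∈ Z) (hy : y ∈ Z) (hz : z ∈ Z)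
    {c : WithTop (Fin d → ℚ)} (h₁ : c < contact x y) (h₂ : c < contact y z) : c < contact x z :=
  (hZ.contact_le_or hx hy hz).elim h₁.trans_le h₂.trans_le

theorem HasContacts.hasHeight_iff (hZ : HasContacts Z) {c : WithTop (Fin d → ℚ)} :
    HasHeight Z c ↔
      (∃ x ∈ Z, ∃ y ∈ Z, contact x y = c) ∧ ∀ x ∈ Z, ∀ y ∈ Z, c ≤ contact x y := by
  constructor
  · rintro ⟨⟨x, hx, y, hy, h⟩, h'⟩
    exact ⟨⟨x, hx, y, hy, h.contact_eq⟩, fun x hx y hy => h' ⟨x, hx, y, hy, hZ.hasContact hx hy⟩⟩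
  · rintro ⟨⟨x, hx, y, hy, h⟩, h'⟩
    refine ⟨⟨x, hx, y, hy, (hZ.hasContact_iff hx hy).2 h⟩, ?_⟩
    rintro _ ⟨x, hx, y, hy, hc⟩
    exact hc.contact_eq ▸ h' x hx y hy

/-- The class of `x` under the relation `O(Y, Y') > η` on `B`. -/
def contactClass (B : Set (HahnSeries (Fin d → ℚ) K)) (η : Fin d → ℚ)
    (x : HahnSeries (Fin d → ℚ) K) : Set (HahnSeries (Fin d → ℚ) K) :=
  {y ∈ B | (η : WithTop (Fin d → ℚ)) < contact x y}

theorem mem_contactClass_self {B : Set (HahnSeries (Fin d → ℚ) K)} (η : Fin d → ℚ) (hx : x ∈ B) :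
    x ∈ contactClass B η x :=
  ⟨hx, by rw [contact_self]; exact WithTop.coe_lt_top η⟩

theorem HasContacts.contactClass_eq (hZ : HasContacts Z) {η : Fin d → ℚ} (hx : x ∈ Z)
    (hy : y ∈ contactClass Z η x) : contactClass Z η y = contactClass Z η x := by
  ext z
  refine and_congr_right fun hz => ⟨hZ.lt_trans hx hy.1 hz hy.2, fun h => ?_⟩
  exact hZ.lt_trans hy.1 hx hz (hZ.comm hx hy.1 ▸ hy.2) h

theorem HasHeight.unique {B : Set (HahnSeries (Fin d → ℚ) K)} {c c' : WithTop (Fin d → ℚ)}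
    (h : HasHeight B c) (h' : HasHeight B c') : c = c' := IsLeast.unique h h'

theorem HasContacts.isPostbar_iff (hZ : HasContacts Z) {B' : Set (HahnSeries (Fin d → ℚ) K)} :
    IsPostbar Z B' ↔ ∃ η : Fin d → ℚ, HasHeight Z (η : WithTop (Fin d → ℚ)) ∧
      ∃ x ∈ Z, B' = contactClass Z η x := by
  have key : ∀ η : Fin d → ℚ, ∀ x ∈ Z, {y ∈ Z | ∃ c, HasContact x y c ∧
      (η : WithTop (Fin d → ℚ)) < c} = contactClass Z η x := by
    intro η x hx
    ext y
    refine and_congr_right fun hy => ?_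
    constructor
    · rintro ⟨c, hc, h⟩
      rwa [hc.contact_eq]
    · exact fun h => ⟨_, hZ.hasContact hx hy, h⟩
  constructor
  · rintro ⟨η, hη, x, hx, h⟩
    exact ⟨η, hη, x, hx, h.trans (key η x hx)⟩
  · rintro ⟨η, hη, x, hx, h⟩
    exact ⟨η, hη, x, hx, h.trans (key η x hx).symm⟩

theorem HasContacts.isPostbar_iff_of_hasHeight (hZ : HasContacts Z) {η : Fin d → ℚ}
    (hη : HasHeight Z (η : WithTop (Fin d → ℚ))) {B' : Set (HahnSeries (Fin d → ℚ) K)} :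
    IsPostbar Z B' ↔ ∃ x ∈ Z, B' = contactClass Z η x := by
  rw [hZ.isPostbar_iff]
  constructor
  · rintro ⟨η', hη', h⟩
    rwa [WithTop.coe_inj.1 (hη.unique hη')]
  · exact fun h => ⟨η, hη, h⟩

theorem IsPostbar.subset {B B' : Set (HahnSeries (Fin d → ℚ) K)} (h : IsPostbar B B') : B' ⊆ B := by
  obtain ⟨η, -, x, -, rfl⟩ := h
  exact fun y hy => hy.1

theorem IsBar.subset {B : Set (HahnSeries (Fin d → ℚ) K)} (h : IsBar Z B) : B ⊆ Z := by
  induction h with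
  | root _ => exact subset_rfl
  | postbar _ h ih => exact h.subset.trans ih

/-! ### Contact preserving bijections and equality of tree models -/

variable {Z' : Set (HahnSeries (Fin d → ℚ) K)}
  {φ : HahnSeries (Fin d → ℚ) K → HahnSeries (Fin d → ℚ) K}

theorem hasHeight_image_iff (hZ : HasContacts Z) (hZ' : HasContacts (φ '' Z))
    (hc : ∀ x ∈ Z, ∀ y ∈ Z, contact (φ x) (φ y) = contact x y) {c : WithTop (Fin d → ℚ)} :
    HasHeight (φ '' Z) c ↔ HasHeight Z c := by
  rw [hZ.hasHeight_iff, hZ'.hasHeight_iff]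
  simp only [Set.exists_mem_image, Set.forall_mem_image]
  refine and_congr ?_ ?_
  · constructor
    · rintro ⟨x, hx, y, hy, h⟩
      exact ⟨x, hx, y, hy, hc x hx y hy ▸ h⟩
    · rintro ⟨x, hx, y, hy, h⟩
      exact ⟨x, hx, y, hy, (hc x hx y hy).trans h⟩
  · constructor
    · intro h x hx y hy
      exact hc x hx y hy ▸ h hx hy
    · intro h x hx y hy
      exact (h x hx y hy).trans (hc x hx y hy).ge

theorem isPostbar_image_iff (hZ : HasContacts Z) (hZ' : HasContacts (φ '' Z))
    (hc : ∀ x ∈ Z, ∀ y ∈ Z, contact (φ x) (φ y) = contact x y)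
    {P' : Set (HahnSeries (Fin d → ℚ) K)} :
    IsPostbar (φ '' Z) P' ↔ ∃ P, IsPostbar Z P ∧ P' = φ '' P := by
  have key : ∀ η, ∀ x ∈ Z, contactClass (φ '' Z) η (φ x) = φ '' contactClass Z η x := by
    intro η x hx
    ext z
    constructor
    · rintro ⟨⟨y, hy, rfl⟩, h⟩
      exact ⟨y, ⟨hy, hc x hx y hy ▸ h⟩, rfl⟩
    · rintro ⟨y, ⟨hy, h⟩, rfl⟩
      exact ⟨⟨y, hy, rfl⟩, h.trans_eq (hc x hx y hy).symm⟩
  simp only [hZ.isPostbar_iff, hZ'.isPostbar_iff, hasHeight_image_iff hZ hZ' hc,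
    Set.exists_mem_image]
  constructor
  · rintro ⟨η, hη, x, hx, rfl⟩
    exact ⟨_, ⟨η, hη, x, hx, rfl⟩, key η x hx⟩
  · rintro ⟨_, ⟨η, hη, x, hx, rfl⟩, rfl⟩
    exact ⟨η, hη, x, hx, (key η x hx).symm⟩

/-- Heights and postbars are defined by contacts alone, so `B ↦ φ '' B` respects them; induction on
bars shows that it maps onto the bars of `Z'`. -/
theorem treeEquiv_of_bijOn (hZ : HasContacts Z) (hZ' : HasContacts Z') (hφ : Set.BijOn φ Z Z')
    (hc : ∀ x ∈ Z, ∀ y ∈ Z, contact (φ x) (φ y) = contact x y) : TreeEquiv Z Z' := by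
  have hcont : ∀ {B}, B ⊆ Z → HasContacts B := fun h => hZ.mono h
  have hcont' : ∀ {B}, B ⊆ Z → HasContacts (φ '' B) := fun h =>
    hZ'.mono ((Set.image_mono h).trans hφ.image_eq.subset)
  have hcB : ∀ {B}, B ⊆ Z → ∀ x ∈ B, ∀ y ∈ B, contact (φ x) (φ y) = contact x y :=
    fun h x hx y hy => hc x (h hx) y (h hy)
  have hbar : ∀ {B}, IsBar Z B → IsBar Z' (φ '' B) := by
    intro B hB
    induction hB with
    | root h =>
      rw [hφ.image_eq]
      exact .root (hφ.image_eq ▸ h.image φ)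
    | postbar hB h ih =>
      exact .postbar ih ((isPostbar_image_iff (hcont hB.subset) (hcont' hB.subset)
        (hcB hB.subset)).2 ⟨_, h, rfl⟩)
  have hsurj : ∀ {B'}, IsBar Z' B' → ∃ B, IsBar Z B ∧ φ '' B = B' := by
    intro B' hB'
    induction hB' with
    | root h => exact ⟨Z, .root (Set.image_nonempty.1 (hφ.image_eq.symm ▸ h)), hφ.image_eq⟩
    | postbar _ h ih =>
      obtain ⟨B, hB, rfl⟩ := ih
      obtain ⟨P, hP, rfl⟩ := (isPostbar_image_iff (hcont hB.subset) (hcont' hB.subset)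
        (hcB hB.subset)).1 h
      exact ⟨P, .postbar hB hP, rfl⟩
  have hinj : ∀ {B C}, B ⊆ Z → C ⊆ Z → φ '' B = φ '' C → B = C := fun hB hC h =>
    (hφ.injOn.image_eq_image_iff hB hC).1 h
  refine ⟨Equiv.ofBijective (fun B => ⟨φ '' B.1, hbar B.2⟩) ⟨?_, ?_⟩, ?_, ?_⟩
  · rintro ⟨B, hB⟩ ⟨C, hC⟩ h
    exact Subtype.ext (hinj hB.subset hC.subset (congrArg Subtype.val h))
  · rintro ⟨B', hB'⟩
    obtain ⟨B, hB, rfl⟩ := hsurj hB'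
    exact ⟨⟨B, hB⟩, rfl⟩
  · rintro ⟨B, hB⟩ ⟨C, hC⟩
    change IsPostbar B C ↔ IsPostbar (φ '' B) (φ '' C)
    rw [isPostbar_image_iff (hcont hB.subset) (hcont' hB.subset) (hcB hB.subset)]
    constructor
    · exact fun h => ⟨C, h, rfl⟩
    · rintro ⟨P, hP, h⟩
      rwa [hinj hC.subset (hP.subset.trans hB.subset) h]
  · rintro ⟨B, hB⟩ c
    exact (hasHeight_image_iff (hcont hB.subset) (hcont' hB.subset) (hcB hB.subset)).symm

/-- Contact preserving bijections between corresponding postbars of two bars of the same height can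
be glued. -/
theorem exists_bijOn_of_postbars (hZ : HasContacts Z) (hZ' : HasContacts Z') {η : Fin d → ℚ}
    (hη : HasHeight Z (η : WithTop (Fin d → ℚ))) (hη' : HasHeight Z' (η : WithTop (Fin d → ℚ)))
    {σ : Set (HahnSeries (Fin d → ℚ) K) → Set (HahnSeries (Fin d → ℚ) K)}
    (hσ : Set.BijOn σ {P | IsPostbar Z P} {P | IsPostbar Z' P})
    (ψ : Set (HahnSeries (Fin d → ℚ) K) → HahnSeries (Fin d → ℚ) K → HahnSeries (Fin d → ℚ) K)
    (hψ : ∀ P, IsPostbar Z P → Set.BijOn (ψ P) P (σ P))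
    (hψc : ∀ P, IsPostbar Z P → ∀ x ∈ P, ∀ y ∈ P, contact (ψ P x) (ψ P y) = contact x y) :
    ∃ φ, Set.BijOn φ Z Z' ∧ ∀ x ∈ Z, ∀ y ∈ Z, contact (φ x) (φ y) = contact x y := by
  have hpost : ∀ {P}, IsPostbar Z P ↔ ∃ x ∈ Z, P = contactClass Z η x :=
    hZ.isPostbar_iff_of_hasHeight hη
  have hpost' : ∀ {P}, IsPostbar Z' P ↔ ∃ x ∈ Z', P = contactClass Z' η x :=
    hZ'.isPostbar_iff_of_hasHeight hη'
  have hcls : ∀ {x}, x ∈ Z → IsPostbar Z (contactClass Z η x) := fun hx => hpost.2 ⟨_, hx, rfl⟩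
  have hcls' : ∀ {P x}, IsPostbar Z' P → x ∈ P → P = contactClass Z' η x := by
    intro P x hP hx
    obtain ⟨y, hy, rfl⟩ := hpost'.1 hP
    exact (hZ'.contactClass_eq hy hx).symm
  let φ : HahnSeries (Fin d → ℚ) K → HahnSeries (Fin d → ℚ) K := fun x => ψ (contactClass Z η x) x
  have hmem : ∀ {x}, x ∈ Z → φ x ∈ σ (contactClass Z η x) := fun hx =>
    (hψ _ (hcls hx)).mapsTo (mem_contactClass_self η hx)
  have hmaps : Set.MapsTo φ Z Z' := fun x hx =>
    (hσ.mapsTo (hcls hx)).subset (hmem hx)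
  have hσc : ∀ {x}, x ∈ Z → σ (contactClass Z η x) = contactClass Z' η (φ x) := fun hx =>
    hcls' (hσ.mapsTo (hcls hx)) (hmem hx)
  have hcontact : ∀ x ∈ Z, ∀ y ∈ Z, contact (φ x) (φ y) = contact x y := by
    intro x hx y hy
    by_cases hxy : y ∈ contactClass Z η x
    · have h1 := hZ.contactClass_eq hx hxy
      change contact (ψ _ x) (ψ (contactClass Z η y) y) = _
      rw [h1]
      exact hψc _ (hcls hx) x (mem_contactClass_self η hx) y hxy
    -- Elements of different postbars have contact exactly `η`. So do their images, since `σ` keeps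
    -- distinct postbars distinct.
    · have h1 : contact x y = η := by
        by_contra hne
        exact hxy ⟨hy, lt_of_le_of_ne ((hZ.hasHeight_iff.1 hη).2 x hx y hy) (Ne.symm hne)⟩
      rw [h1]
      by_contra hne
      apply hxy
      have h2 : φ y ∈ contactClass Z' η (φ x) := ⟨hmaps hy, lt_of_le_of_ne
        ((hZ'.hasHeight_iff.1 hη').2 _ (hmaps hx) _ (hmaps hy)) (Ne.symm hne)⟩
      have h3 := hZ'.contactClass_eq (hmaps hx) h2
      rw [← hσc hx, ← hσc hy] at h3
      rw [← hσ.injOn (hcls hy) (hcls hx) h3]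
      exact mem_contactClass_self η hy
  refine ⟨φ, ⟨hmaps, fun x hx y hy hxy => ?_, fun z hz => ?_⟩, hcontact⟩
  · have := hcontact x hx y hy
    rw [hxy, contact_self] at this
    exact hZ.eq_of_top_le hx hy this.le
  · obtain ⟨P, hP, hPz⟩ := hσ.surjOn (hpost'.2 ⟨z, hz, rfl⟩)
    obtain ⟨x, hx, hxz⟩ := (hψ P hP).surjOn (hPz ▸ mem_contactClass_self η hz)
    refine ⟨x, IsPostbar.subset hP hx, ?_⟩
    obtain ⟨y, hy, rfl⟩ := hpost.1 hP
    change ψ (contactClass Z η x) x = z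
    rw [hZ.contactClass_eq hy hx, hxz]

/-! ### Uniqueness of the tree model of a given type -/

variable {g : ℕ} {h : Fin g → (Fin d → ℚ)}

theorem extSeq_of_lt {i : ℕ} (hi : i < g) :
    extSeq h i = ((h ⟨i, hi⟩ : Fin d → ℚ) : WithTop (Fin d → ℚ)) := dif_pos hi

theorem extSeq_of_le {i : ℕ} (hi : g ≤ i) : extSeq h i = ⊤ := dif_neg hi.not_gt

theorem extSeq_lt (hs : StrictMono h) {i j : ℕ} (hij : i < j) (hi : i < g) :
    extSeq h i < extSeq h j := by
  rw [extSeq_of_lt hi]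
  rcases lt_or_ge j g with hj | hj
  · rw [extSeq_of_lt hj]
    exact WithTop.coe_lt_coe.2 (hs hij)
  · rw [extSeq_of_le hj]
    exact WithTop.coe_lt_top _

theorem extSeq_le (hs : StrictMono h) {i j : ℕ} (hij : i ≤ j) : extSeq h i ≤ extSeq h j := by
  rcases lt_or_ge i g with hi | hi
  · rcases hij.eq_or_lt with rfl | hlt
    · exact le_rfl
    · exact (extSeq_lt hs hlt hi).le
  · rw [extSeq_of_le hi, extSeq_of_le (hi.trans hij)]

theorem insert_top_range_eq :
    insert ⊤ (Set.range fun i => ((h i : Fin d → ℚ) : WithTop (Fin d → ℚ))) =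
      {c | ∃ i ≤ g, c = extSeq h i} := by
  ext c
  constructor
  · rintro (rfl | ⟨i, rfl⟩)
    · exact ⟨g, le_rfl, (extSeq_of_le le_rfl).symm⟩
    · exact ⟨i, i.2.le, (extSeq_of_lt i.2).symm⟩
  · rintro ⟨i, hi, rfl⟩
    rcases hi.eq_or_lt with rfl | hi
    · exact Or.inl (extSeq_of_le le_rfl)
    · exact Or.inr ⟨⟨i, hi⟩, (extSeq_of_lt hi).symm⟩

/-- Some bar attains the smallest listed height. Its elements lie in `Z`, so the height of `Z` is no
larger, and being listed it is no smaller. -/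
theorem IsTreeOfType.hasHeight_root (hT : IsTreeOfType Z h) (hZ : HasContacts Z)
    (hs : StrictMono h) : Z.Nonempty ∧ HasHeight Z (extSeq h 0) := by
  have hmem := hT.heights
  rw [insert_top_range_eq] at hmem
  obtain ⟨B, hB, hBh⟩ := hmem.symm.subset ⟨0, Nat.zero_le g, rfl⟩
  obtain ⟨⟨x, hx, y, hy, hxy⟩, -⟩ := (hZ.mono hB.subset).hasHeight_iff.1 hBh
  have hne : Z.Nonempty := ⟨x, hB.subset hx⟩
  obtain ⟨c, hc⟩ := hT.hasHeight Z (.root hne)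
  obtain ⟨i, hi, rfl⟩ := hmem.subset ⟨Z, .root hne, hc⟩
  have h1 := (hZ.hasHeight_iff.1 hc).2 x (hB.subset hx) y (hB.subset hy)
  rw [hxy] at h1
  rw [le_antisymm (extSeq_le hs (Nat.zero_le i)) h1]
  exact ⟨hne, hc⟩

/-- Induction on `n = g - i`. Bars of height `∞` are singletons; at a finite height the numbers of
postbars agree and are finite, so any matching can be refined recursively and glued. -/
theorem IsTreeOfType.exists_bijOn (hT : IsTreeOfType Z h) (hT' : IsTreeOfType Z' h)
    (hZ : HasContacts Z) (hZ' : HasContacts Z') (n i : ℕ) (hn : i + n = g)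
    {B B' : Set (HahnSeries (Fin d → ℚ) K)} (hB : IsBar Z B) (hB' : IsBar Z' B')
    (hh : HasHeight B (extSeq h i)) (hh' : HasHeight B' (extSeq h i)) :
    ∃ φ, Set.BijOn φ B B' ∧ ∀ x ∈ B, ∀ y ∈ B, contact (φ x) (φ y) = contact x y := by
  have hBc := hZ.mono hB.subset
  have hBc' := hZ'.mono hB'.subset
  induction n generalizing i B B' with
  | zero =>
    rw [extSeq_of_le (by omega)] at hh hh'
    obtain ⟨⟨x, hx, -⟩, hall⟩ := hBc.hasHeight_iff.1 hh
    obtain ⟨⟨x', hx', -⟩, hall'⟩ := hBc'.hasHeight_iff.1 hh'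
    have heq : ∀ y ∈ B, ∀ z ∈ B, y = z := fun y hy z hz =>
      hBc.eq_of_top_le hy hz (hall y hy z hz)
    refine ⟨fun _ => x', ⟨fun _ _ => hx', fun y hy z hz _ => heq y hy z hz, fun z hz => ?_⟩, ?_⟩
    · exact ⟨x, hx, hBc'.eq_of_top_le hx' hz (hall' x' hx' z hz)⟩
    · intro y hy z hz
      rw [heq y hy z hz, contact_self, contact_self]
  | succ n ih =>
    have hi : i < g := by omega
    rw [extSeq_of_lt hi] at hh hh'
    obtain ⟨hcard, hpost⟩ := hT.postbars ⟨i, hi⟩ B hB hh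
    obtain ⟨hcard', hpost'⟩ := hT'.postbars ⟨i, hi⟩ B' hB' hh'
    obtain ⟨σ, hσ⟩ := (Set.finite_of_encard_eq_coe hcard).exists_bijOn_of_encard_eq
      (hcard.trans hcard'.symm)
    have hex : ∀ P, ∃ ψ, IsPostbar B P → (Set.BijOn ψ P (σ P) ∧
        ∀ x ∈ P, ∀ y ∈ P, contact (ψ x) (ψ y) = contact x y) := by
      intro P
      by_cases hP : IsPostbar B P
      · have hP' : IsPostbar B' (σ P) := hσ.mapsTo hP
        obtain ⟨ψ, hψ⟩ := ih (i + 1) (by omega) (.postbar hB hP) (.postbar hB' hP') (hpost P hP)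
          (hpost' _ hP') (hBc.mono hP.subset) (hBc'.mono hP'.subset)
        exact ⟨ψ, fun _ => hψ⟩
      · exact ⟨id, fun h => absurd h hP⟩
    choose ψ hψ using hex
    exact exists_bijOn_of_postbars hBc hBc' hh hh' hσ ψ (fun P hP => (hψ P hP).1)
      fun P hP => (hψ P hP).2

theorem IsTreeOfType.treeEquiv (hT : IsTreeOfType Z h) (hT' : IsTreeOfType Z' h)
    (hZ : HasContacts Z) (hZ' : HasContacts Z') (hs : StrictMono h) : TreeEquiv Z Z' := by
  obtain ⟨hne, hh⟩ := hT.hasHeight_root hZ hs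
  obtain ⟨hne', hh'⟩ := hT'.hasHeight_root hZ' hs
  obtain ⟨φ, hφ, hc⟩ := hT.exists_bijOn hT' hZ hZ' g 0 (by omega) (.root hne) (.root hne') hh hh'
  exact treeEquiv_of_bijOn hZ hZ' hφ hc

end Contact

/-! ### The tree model of a set whose contacts form a chain -/

section Levels

variable {K : Type*} [Field K] {d g : ℕ} {h : Fin g → (Fin d → ℚ)}
  {Z : Set (HahnSeries (Fin d → ℚ) K)} {x y : HahnSeries (Fin d → ℚ) K}

/-- The elements of `Z` whose contact with `x` is at least the `i`-th term of the extended
sequence. -/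
def levelSet (Z : Set (HahnSeries (Fin d → ℚ) K)) (h : Fin g → (Fin d → ℚ)) (i : ℕ)
    (x : HahnSeries (Fin d → ℚ) K) : Set (HahnSeries (Fin d → ℚ) K) :=
  {y ∈ Z | extSeq h i ≤ contact x y}

/-- For every `x ∈ Z`, the contacts of `x` with elements of `Z` are `h₁,…,h_g,∞`. -/
structure HasContactChain (Z : Set (HahnSeries (Fin d → ℚ) K)) (h : Fin g → (Fin d → ℚ)) :
    Prop where
  strictMono : StrictMono h
  hasContacts : HasContacts Z
  exists_eq : ∀ x ∈ Z, ∀ y ∈ Z, ∃ i ≤ g, contact x y = extSeq h i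
  exists_mem : ∀ x ∈ Z, ∀ i ≤ g, ∃ y ∈ Z, contact x y = extSeq h i

namespace HasContactChain

variable (hZ : HasContactChain Z h)
include hZ

theorem hasHeight_levelSet {i : ℕ} (hi : i ≤ g) (hx : x ∈ Z) :
    HasHeight (levelSet Z h i x) (extSeq h i) := by
  rw [(hZ.hasContacts.mono (fun y hy => hy.1)).hasHeight_iff]
  constructor
  · obtain ⟨y, hy, hxy⟩ := hZ.exists_mem x hx i hi
    exact ⟨x, ⟨hx, by rw [contact_self]; exact le_top⟩, y, ⟨hy, hxy.ge⟩, hxy⟩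
  · rintro y ⟨hy, hxy⟩ z ⟨hz, hxz⟩
    exact hZ.hasContacts.le_trans hy hx hz (hZ.hasContacts.comm hx hy ▸ hxy) hxz

/-- No contact lies strictly between consecutive terms of the extended sequence, so exceeding one
term means reaching the next. -/
theorem contactClass_levelSet {i : ℕ} (hi : i < g) (hx : x ∈ Z) (hy : y ∈ levelSet Z h i x) :
    contactClass (levelSet Z h i x) (h ⟨i, hi⟩) y = levelSet Z h (i + 1) y := by
  ext z
  constructor
  · rintro ⟨⟨hz, -⟩, hyz⟩
    refine ⟨hz, ?_⟩
    obtain ⟨j, hj, hyz'⟩ := hZ.exists_eq y hy.1 z hz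
    rw [hyz'] at hyz ⊢
    rw [← extSeq_of_lt hi] at hyz
    refine extSeq_le hZ.strictMono ?_
    by_contra hji
    exact hyz.not_ge (extSeq_le hZ.strictMono (by omega))
  · rintro ⟨hz, hyz⟩
    have hlt := (extSeq_lt hZ.strictMono (Nat.lt_succ_self i) hi).trans_le hyz
    exact ⟨⟨hz, hZ.hasContacts.le_trans hx hy.1 hz hy.2 hlt.le⟩, extSeq_of_lt hi ▸ hlt⟩

theorem isPostbar_levelSet_iff {i : ℕ} (hi : i < g) (hx : x ∈ Z)
    {P : Set (HahnSeries (Fin d → ℚ) K)} :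
    IsPostbar (levelSet Z h i x) P ↔ ∃ y ∈ levelSet Z h i x, P = levelSet Z h (i + 1) y := by
  rw [(hZ.hasContacts.mono (fun y hy => hy.1)).isPostbar_iff_of_hasHeight
    (extSeq_of_lt hi ▸ hZ.hasHeight_levelSet hi.le hx)]
  refine exists_congr fun y => and_congr_right fun hy => ?_
  rw [hZ.contactClass_levelSet hi hx hy]

theorem levelSet_zero (hx : x ∈ Z) : levelSet Z h 0 x = Z := by
  refine subset_antisymm (fun y hy => hy.1) fun y hy => ⟨hy, ?_⟩
  obtain ⟨j, -, hj⟩ := hZ.exists_eq x hx y hy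
  rw [hj]
  exact extSeq_le hZ.strictMono (Nat.zero_le j)

theorem exists_eq_levelSet {B : Set (HahnSeries (Fin d → ℚ) K)} (hB : IsBar Z B) :
    ∃ i ≤ g, ∃ x ∈ Z, B = levelSet Z h i x := by
  induction hB with
  | root hne =>
    obtain ⟨x, hx⟩ := hne
    exact ⟨0, Nat.zero_le g, x, hx, (hZ.levelSet_zero hx).symm⟩
  | postbar _ hP ih =>
    obtain ⟨i, hi, x, hx, rfl⟩ := ih
    rcases hi.lt_or_eq with hi | rfl
    · obtain ⟨y, hy, rfl⟩ := (hZ.isPostbar_levelSet_iff hi hx).1 hP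
      exact ⟨i + 1, hi, y, hy.1, rfl⟩
    -- Level `g` has height `∞`, so it has no postbars.
    · obtain ⟨η, hη, -⟩ := hP
      have := hη.unique (hZ.hasHeight_levelSet le_rfl hx)
      rw [extSeq_of_le le_rfl] at this
      exact absurd this WithTop.coe_ne_top

theorem isBar_levelSet {i : ℕ} (hi : i ≤ g) (hx : x ∈ Z) : IsBar Z (levelSet Z h i x) := by
  induction i with
  | zero =>
    rw [hZ.levelSet_zero hx]
    exact .root ⟨x, hx⟩
  | succ i ih =>
    refine .postbar (ih (by omega)) ((hZ.isPostbar_levelSet_iff hi hx).2 ⟨x, ⟨hx, ?_⟩, rfl⟩)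
    rw [contact_self]
    exact le_top

theorem eq_of_hasHeight_levelSet {i j : ℕ} (hi : i ≤ g) (hj : j ≤ g) (hx : x ∈ Z)
    (hh : HasHeight (levelSet Z h i x) (extSeq h j)) : i = j := by
  have h1 := hh.unique (hZ.hasHeight_levelSet hi hx)
  rcases lt_trichotomy i j with hij | hij | hij
  · exact absurd h1 (extSeq_lt hZ.strictMono hij (by omega)).ne'
  · exact hij
  · exact absurd h1 (extSeq_lt hZ.strictMono hij (by omega)).ne

theorem isTreeOfType (hne : Z.Nonempty)
    (hcard : ∀ (i : Fin g), ∀ x ∈ Z,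
      {P | ∃ y ∈ levelSet Z h i x, P = levelSet Z h (i + 1) y}.encard =
        (((charLattice h i).relIndex (charLattice h (i + 1)) : ℕ) : ℕ∞)) :
    IsTreeOfType Z h where
  hasHeight B hB := by
    obtain ⟨i, hi, x, hx, rfl⟩ := hZ.exists_eq_levelSet hB
    exact ⟨_, hZ.hasHeight_levelSet hi hx⟩
  heights := by
    rw [insert_top_range_eq]
    ext c
    constructor
    · rintro ⟨B, hB, hc⟩
      obtain ⟨i, hi, x, hx, rfl⟩ := hZ.exists_eq_levelSet hB
      exact ⟨i, hi, hc.unique (hZ.hasHeight_levelSet hi hx)⟩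
    · rintro ⟨i, hi, rfl⟩
      obtain ⟨x, hx⟩ := hne
      exact ⟨_, hZ.isBar_levelSet hi hx, hZ.hasHeight_levelSet hi hx⟩
  postbars := by
    rintro ⟨i, hi⟩ B hB hc
    obtain ⟨j, hj, x, hx, rfl⟩ := hZ.exists_eq_levelSet hB
    rw [← extSeq_of_lt hi] at hc
    obtain rfl := hZ.eq_of_hasHeight_levelSet hj hi.le hx hc
    refine ⟨?_, fun P hP => ?_⟩
    · rw [← hcard ⟨j, hi⟩ x hx]
      congr 1
      ext P
      exact hZ.isPostbar_levelSet_iff hi hx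
    · obtain ⟨y, hy, rfl⟩ := (hZ.isPostbar_levelSet_iff hi hx).1 hP
      exact hZ.hasHeight_levelSet hi hy.1

end HasContactChain

end Levels

/-! ### Counting postbars -/

section Count

theorem intLattice_le_charLattice {d g : ℕ} (h : Fin g → (Fin d → ℚ)) (i : ℕ) :
    intLattice d ≤ charLattice h i := fun _ hv =>
  AddSubgroup.subset_closure (Or.inl (mem_intLattice.1 hv))

theorem mem_charLattice {d g : ℕ} (h : Fin g → (Fin d → ℚ)) {i : ℕ} {j : Fin g} (hj : (j : ℕ) < i) :
    h j ∈ charLattice h i :=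
  AddSubgroup.subset_closure (Or.inr ⟨j, hj, rfl⟩)

theorem charLattice_le {d g : ℕ} {h : Fin g → (Fin d → ℚ)} {i : ℕ} {N : AddSubgroup (Fin d → ℚ)}
    (h₁ : intLattice d ≤ N) (h₂ : ∀ j : Fin g, (j : ℕ) < i → h j ∈ N) : charLattice h i ≤ N := by
  refine (AddSubgroup.closure_le _).2 ?_
  rintro v (hv | ⟨j, hj, rfl⟩)
  · exact h₁ (mem_intLattice.2 hv)
  · exact h₂ j hj

/-- The image of the larger lattice in the quotient by the smaller one is cyclic, generated by the
class of the added exponent. -/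
theorem relIndex_charLattice_succ {d g : ℕ} (h : Fin g → (Fin d → ℚ)) (i : Fin g) :
    (charLattice h i).relIndex (charLattice h (i + 1)) =
      addOrderOf ((h i : Fin d → ℚ) : (Fin d → ℚ) ⧸ charLattice h i) := by
  have h1 : (QuotientAddGroup.mk' (charLattice h i)).ker.relIndex (charLattice h (i + 1)) =
      Nat.card ((charLattice h (i + 1)).map (QuotientAddGroup.mk' (charLattice h i))) :=
    AddSubgroup.relIndex_ker _ _
  rw [QuotientAddGroup.ker_mk'] at h1
  rw [h1, ← Nat.card_zmultiples]
  refine congrArg (fun N : AddSubgroup ((Fin d → ℚ) ⧸ charLattice h i) => Nat.card N) ?_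
  apply le_antisymm
  · rw [AddSubgroup.map_le_iff_le_comap]
    refine charLattice_le (fun v hv => ?_) fun j hj => ?_
    · have : (QuotientAddGroup.mk' (charLattice h i)) v = 0 :=
        (QuotientAddGroup.eq_zero_iff v).2 (intLattice_le_charLattice h i hv)
      rw [AddSubgroup.mem_comap, this]
      exact zero_mem _
    · rw [AddSubgroup.mem_comap]
      rcases Nat.lt_succ_iff_lt_or_eq.1 hj with hj | hj
      · have : (QuotientAddGroup.mk' (charLattice h i)) (h j) = 0 :=
          (QuotientAddGroup.eq_zero_iff _).2 (mem_charLattice h hj)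
        rw [this]
        exact zero_mem _
      · rw [Fin.ext hj]
        exact AddSubgroup.mem_zmultiples _
  · rw [AddSubgroup.zmultiples_le]
    exact ⟨h i, mem_charLattice h (Nat.lt_succ_self _), rfl⟩

/-- The values are exactly the `r`-th roots of unity, `r` being the order of `a` modulo `N`, and `K`
contains `r` of them. -/
theorem encard_charVal {K : Type*} [Field K] [IsAlgClosed K] [CharZero K]
    {A : Type*} [AddCommGroup A] (N : AddSubgroup A) (a : A)
    (hr : 0 < addOrderOf (a : A ⧸ N)) :
    {z : K | ∃ χ : A →+ Additive Kˣ, (∀ v ∈ N, χ v = 0) ∧ charVal χ a = z}.encard =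
      ((addOrderOf (a : A ⧸ N) : ℕ) : ℕ∞) := by
  set r := addOrderOf (a : A ⧸ N) with hrdef
  have hrN : r • a ∈ N := by
    rw [← QuotientAddGroup.eq_zero_iff]
    exact addOrderOf_nsmul_eq_zero (a : A ⧸ N)
  have : NeZero r := ⟨hr.ne'⟩
  obtain ⟨ζ, hζ⟩ := exists_isPrimitiveRoot_units (K := K) r hr
  have h1 : {z : K | ∃ χ : A →+ Additive Kˣ, (∀ v ∈ N, χ v = 0) ∧ charVal χ a = z} =
      (fun u : Kˣ => (u : K)) '' (rootsOfUnity r K : Set Kˣ) := by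
    ext z
    constructor
    · rintro ⟨χ, hχ, rfl⟩
      refine ⟨(χ a).toMul, ?_, rfl⟩
      have h2 := hχ _ hrN
      rw [map_nsmul] at h2
      exact (mem_rootsOfUnity r _).2 h2
    · rintro ⟨u, hu, rfl⟩
      obtain ⟨χ, hχ, hχa⟩ := exists_character N a u ((mem_rootsOfUnity r u).1 hu)
      exact ⟨χ, hχ, by rw [charVal, hχa]; rfl⟩
  have h2 : Nat.card (rootsOfUnity r K) = r :=
    (hζ.map_of_injective (f := Units.coeHom K) Units.val_injective).card_rootsOfUnity
  have hfin : (rootsOfUnity r K : Set Kˣ).Finite :=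
    Set.finite_of_ncard_ne_zero (h2.trans_ne hr.ne')
  rw [h1, Function.Injective.encard_image Units.val_injective, ← hfin.cast_ncard_eq]
  exact congrArg Nat.cast h2

variable {K : Type*} [Field K] {d g : ℕ} {h : Fin g → (Fin d → ℚ)}
  {Z : Set (HahnSeries (Fin d → ℚ) K)} {x : HahnSeries (Fin d → ℚ) K}

/-- Reaching level `i` means agreeing with `x` at the exponents `h j` with `j < i`. As `x` has
non-zero coefficients there, this says that `χ` is trivial on these exponents. -/
theorem HasContactChain.twist_mem_levelSet_iff (hZ : HasContactChain Z h)
    {χ : (Fin d → ℚ) →+ Additive Kˣ} (hχ : ∀ v ∈ intLattice d, χ v = 0) (hx : x ∈ Z)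
    (hχx : twist χ x ∈ Z) (hcoeff : ∀ j, x.coeff (h j) ≠ 0) (i : ℕ) :
    twist χ x ∈ levelSet Z h i x ↔ ∀ v ∈ charLattice h i, χ v = 0 := by
  constructor
  · rintro ⟨-, hle⟩
    refine charLattice_le (N := χ.ker) hχ fun j hj => ?_
    have h1 : x.coeff (h j) = (twist χ x).coeff (h j) := by
      by_contra hne
      have h2 := hle.trans (hZ.hasContacts.contact_le hx hχx hne)
      have h3 : extSeq h j = h j := extSeq_of_lt j.2
      rw [← h3] at h2
      exact h2.not_gt (extSeq_lt hZ.strictMono hj j.2)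
    rw [coeff_twist] at h1
    exact charVal_eq_one_iff.1 ((mul_eq_right₀ (hcoeff j)).1 h1.symm)
  · intro hN
    refine ⟨hχx, ?_⟩
    obtain ⟨j, hj, hc⟩ := hZ.exists_eq x hx _ hχx
    rw [hc]
    rcases hj.lt_or_eq with hj | rfl
    · refine extSeq_le hZ.strictMono (not_lt.1 fun hji => ?_)
      rw [extSeq_of_lt hj] at hc
      refine hZ.hasContacts.coeff_ne hx hχx hc ?_
      rw [coeff_twist, charVal_eq_one_iff.2 (hN _ (mem_charLattice h (j := ⟨j, hj⟩) hji)), one_mul]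
    · rw [extSeq_of_le le_rfl]
      exact le_top

/-- Within this bar all contacts are at least `h i`, and equality holds exactly when the
coefficients at `h i` differ. -/
theorem HasContactChain.levelSet_succ_eq_iff (hZ : HasContactChain Z h) (i : Fin g) (hx : x ∈ Z)
    {y z : HahnSeries (Fin d → ℚ) K} (hy : y ∈ levelSet Z h i x) (hz : z ∈ levelSet Z h i x) :
    levelSet Z h (i + 1) y = levelSet Z h (i + 1) z ↔ y.coeff (h i) = z.coeff (h i) := by
  have hU : HasContacts (levelSet Z h i x) := hZ.hasContacts.mono fun y hy => hy.1
  rw [← hZ.contactClass_levelSet i.2 hx hy, ← hZ.contactClass_levelSet i.2 hx hz]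
  constructor
  · intro heq
    have h1 := heq.symm.subset (mem_contactClass_self _ hz)
    by_contra hne
    exact (h1.2.trans_le (hU.contact_le hy hz hne)).false
  · intro heq
    refine (hU.contactClass_eq hy ⟨hz, lt_of_le_of_ne ?_ fun h1 => ?_⟩).symm
    · exact (hU.hasHeight_iff.1 (extSeq_of_lt i.2 ▸ hZ.hasHeight_levelSet i.2.le hx)).2 y hy z hz
    · exact hU.coeff_ne hy hz h1.symm heq

theorem encard_image_eq_encard_image {α β γ : Type*} {s : Set α} {u : α → β} {v : α → γ}
    (huv : ∀ x ∈ s, ∀ y ∈ s, u x = u y ↔ v x = v y) : (u '' s).encard = (v '' s).encard := by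
  have hw : ∀ b ∈ u '' s, ∃ x ∈ s, u x = b := fun b hb => hb
  rcases s.eq_empty_or_nonempty with rfl | ⟨a, -⟩
  · simp
  have : Nonempty α := ⟨a⟩
  choose! w hws hwu using hw
  have h1 : (fun b => v (w b)) '' (u '' s) = v '' s := by
    rw [Set.image_image]
    refine Set.image_congr fun x hx => ?_
    have hx' := Set.mem_image_of_mem u hx
    exact (huv _ (hws _ hx') _ hx).1 (hwu _ hx')
  have h2 : Set.InjOn (fun b => v (w b)) (u '' s) := fun b hb c hc hbc => by
    rw [← hwu b hb, ← hwu c hc]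
    exact (huv _ (hws b hb) _ (hws c hc)).2 hbc
  rw [← h1, h2.encard_image]

theorem HasContactChain.encard_postbars [IsAlgClosed K] [CharZero K] (hZ : HasContactChain Z h)
    (hmem : ∀ χ : (Fin d → ℚ) →+ Additive Kˣ, (∀ v ∈ intLattice d, χ v = 0) → twist χ x ∈ Z)
    (htrans : ∀ y ∈ Z, ∃ χ : (Fin d → ℚ) →+ Additive Kˣ,
      (∀ v ∈ intLattice d, χ v = 0) ∧ twist χ x = y) (i : Fin g) (hx : x ∈ Z)
    (hfin : 0 < addOrderOf ((h i : Fin d → ℚ) : (Fin d → ℚ) ⧸ charLattice h i)) :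
    {P | ∃ y ∈ levelSet Z h i x, P = levelSet Z h (i + 1) y}.encard =
      (((charLattice h i).relIndex (charLattice h (i + 1)) : ℕ) : ℕ∞) := by
  -- Some conjugate of `x` has contact `h j` with `x`, hence a different coefficient there; if that
  -- of `x` were zero, both would be.
  have hcoeff : ∀ j, x.coeff (h j) ≠ 0 := by
    intro j hj
    obtain ⟨y, hy, hxy⟩ := hZ.exists_mem x hx j j.2.le
    rw [extSeq_of_lt j.2] at hxy
    refine hZ.hasContacts.coeff_ne hx hy hxy ?_
    obtain ⟨χ, -, rfl⟩ := htrans y hy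
    change x.coeff (h j) = _
    rw [coeff_twist, hj, mul_zero]
  have h1 : {P | ∃ y ∈ levelSet Z h i x, P = levelSet Z h (i + 1) y} =
      levelSet Z h (i + 1) '' levelSet Z h i x := by
    ext P
    exact exists_congr fun y => and_congr_right fun _ => eq_comm
  have h2 : (fun y : HahnSeries (Fin d → ℚ) K => y.coeff (h i)) '' levelSet Z h i x =
      (· * x.coeff (h i)) '' {z : K | ∃ χ : (Fin d → ℚ) →+ Additive Kˣ,
        (∀ v ∈ charLattice h i, χ v = 0) ∧ charVal χ (h i) = z} := by
    ext z
    constructor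
    · rintro ⟨y, hy, rfl⟩
      obtain ⟨χ, hχ, rfl⟩ := htrans y hy.1
      exact ⟨_, ⟨χ, (hZ.twist_mem_levelSet_iff hχ hx (hmem χ hχ) hcoeff i).1 hy, rfl⟩, rfl⟩
    · rintro ⟨_, ⟨χ, hχ, rfl⟩, rfl⟩
      have hχ' : ∀ v ∈ intLattice d, χ v = 0 := fun v hv => hχ v (intLattice_le_charLattice h i hv)
      exact ⟨_, (hZ.twist_mem_levelSet_iff hχ' hx (hmem χ hχ') hcoeff i).2 hχ, rfl⟩
  rw [h1, encard_image_eq_encard_image fun y hy z hz => hZ.levelSet_succ_eq_iff i hx hy hz, h2,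
    (mul_left_injective₀ (hcoeff i)).encard_image, encard_charVal _ _ hfin,
    relIndex_charLattice_succ]

end Count

/-! ### The tree model of an irreducible polynomial -/

section Irreducible

variable {K : Type*} [Field K] {d g : ℕ} {h : Fin g → (Fin d → ℚ)}

theorem HasContacts.contact_eq_coe {Z : Set (HahnSeries (Fin d → ℚ) K)} (hZ : HasContacts Z)
    {x y : HahnSeries (Fin d → ℚ) K} (hx : x ∈ Z) (hy : y ∈ Z) {q : Fin d → ℚ}
    (hq : IsLeast (x - y).support q) : contact x y = q := by
  have hc := hZ.hasContact hx hy
  generalize contact x y = c at hc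
  induction c with
  | top =>
    have := hq.1
    simp [hc.eq_of_top] at this
  | coe p => rw [hc.isLeast.unique hq]

theorem HasContacts.contact_twist {Z : Set (HahnSeries (Fin d → ℚ) K)} (hZ : HasContacts Z)
    {χ : (Fin d → ℚ) →+ Additive Kˣ} (hχ : ∀ x ∈ Z, twist χ x ∈ Z)
    {x y : HahnSeries (Fin d → ℚ) K} (hx : x ∈ Z) (hy : y ∈ Z) :
    contact (twist χ x) (twist χ y) = contact x y := by
  have hc := hZ.hasContact hx hy
  generalize contact x y = c at hc
  induction c with
  | top => rw [hc.eq_of_top, contact_self]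
  | coe q =>
    refine hZ.contact_eq_coe (hχ x hx) (hχ y hy) ?_
    rw [← map_sub, support_twist]
    exact hc.isLeast

theorem hasContacts_Zer {p : Polynomial (MvPowerSeries (Fin d) K)} (hm : p.Monic)
    (hQ : IsQuasiOrdinary p) : HasContacts (Zer p) := fun _ hx _ hy => exists_hasContact hm hQ hx hy

theorem twist_neg_twist (χ : (Fin d → ℚ) →+ Additive Kˣ) (x : HahnSeries (Fin d → ℚ) K) :
    twist χ (twist (-χ) x) = x := by
  ext q
  rw [coeff_twist, coeff_twist, ← mul_assoc, ← charVal_add_left,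
    charVal_eq_one_iff.2 (by simp), one_mul]

/-- A contact has a common denominator `k`, so `k • h i` is integral. This excludes the value `0`
that `addOrderOf` takes at infinite order. -/
theorem addOrderOf_pos_of_isCharSeq {f : Polynomial (MvPowerSeries (Fin d) K)}
    (hchar : IsCharSeq f h) (i : Fin g) :
    0 < addOrderOf ((h i : Fin d → ℚ) : (Fin d → ℚ) ⧸ charLattice h i) := by
  obtain ⟨-, Y, -, hset⟩ := hchar
  obtain ⟨Y', -, hne, hc⟩ := hset.symm.subset ⟨i, rfl⟩
  rcases hc with ⟨heq, -⟩ | ⟨k, n, -, -, -, hn⟩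
  · exact absurd heq hne
  · refine addOrderOf_pos_of_nsmul_mem k (intLattice_le_charLattice h i ?_)
    rw [WithTop.coe_inj.1 hn]
    exact nsmul_divExp_mem_intLattice k n

variable [IsAlgClosed K] [CharZero K]

/-- The contacts are prescribed for one root `Y` only. A character moving `Y` to `x` permutes the
roots and preserves contacts, so `x` has the same ones. -/
theorem hasContactChain_Zer {f : Polynomial (MvPowerSeries (Fin d) K)} (hm : f.Monic)
    (hQ : IsQuasiOrdinary f) (hirr : Irreducible f) (hchar : IsCharSeq f h) :
    HasContactChain (Zer f) h := by
  obtain ⟨hs, Y, hY, hset⟩ := hchar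
  have hZ := hasContacts_Zer hm hQ
  refine ⟨hs, hZ, fun x hx y hy => ?_, fun x hx i hi => ?_⟩
  · obtain ⟨χ, hχ, rfl⟩ := exists_twist_eq hm hirr hY hx
    have hχ' : ∀ v ∈ intLattice d, (-χ) v = 0 := fun v hv => by
      rw [AddMonoidHom.neg_apply, hχ v hv, neg_zero]
    have hy' := twist_mem_Zer hχ' hy
    rw [← twist_neg_twist χ y, hZ.contact_twist (fun x hx => twist_mem_Zer hχ hx) hY hy']
    by_cases heq : twist (-χ) y = Y
    · exact ⟨g, le_rfl, by rw [heq, contact_self, extSeq_of_le le_rfl]⟩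
    · obtain ⟨i, hi⟩ := hset.subset ⟨_, hy', heq, hZ.hasContact hy' hY⟩
      exact ⟨i, i.2.le, by rw [hZ.comm hY hy', ← hi, extSeq_of_lt i.2]⟩
  · rcases hi.lt_or_eq with hi | rfl
    · obtain ⟨χ, hχ, rfl⟩ := exists_twist_eq hm hirr hY hx
      obtain ⟨Y', hY', -, hc⟩ := hset.symm.subset ⟨⟨i, hi⟩, rfl⟩
      refine ⟨twist χ Y', twist_mem_Zer hχ hY', ?_⟩
      rw [hZ.contact_twist (fun x hx => twist_mem_Zer hχ hx) hY hY', hZ.comm hY hY',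
        hc.contact_eq, extSeq_of_lt hi]
    · exact ⟨x, hx, by rw [contact_self, extSeq_of_le le_rfl]⟩

theorem isTreeOfType_Zer {f : Polynomial (MvPowerSeries (Fin d) K)} (hm : f.Monic)
    (hQ : IsQuasiOrdinary f) (hirr : Irreducible f) (hchar : IsCharSeq f h) :
    IsTreeOfType (Zer f) h := by
  have hZ := hasContactChain_Zer hm hQ hirr hchar
  refine hZ.isTreeOfType ⟨_, hchar.2.choose_spec.1⟩ fun i x hx => ?_
  exact hZ.encard_postbars (fun χ hχ => twist_mem_Zer hχ hx)
    (fun y hy => exists_twist_eq hm hirr hx hy) i hx (addOrderOf_pos_of_isCharSeq hchar i)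

end Irreducible

end

end QuasiOrdinary

open QuasiOrdinary in
theorem theorem4 {K : Type*} [Field K] [IsAlgClosed K] [CharZero K] (d : ℕ)
    (f : Polynomial (MvPowerSeries (Fin d) K)) (hW : IsWeierstrass f) (hQ : IsQuasiOrdinary f)
    (hirr : Irreducible f) (g : ℕ) (h : Fin g → (Fin d → ℚ)) (hchar : IsCharSeq f h) :
    IsTreeOfType (Zer f) h ∧
      ∀ p : Polynomial (MvPowerSeries (Fin d) K), IsWeierstrass p → IsQuasiOrdinary p →
        IsTreeOfType (Zer p) h → TreeEquiv (Zer f) (Zer p) := by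
  have hZ := hasContacts_Zer hW.1 hQ
  have hT := isTreeOfType_Zer hW.1 hQ hirr hchar
  exact ⟨hT, fun p hpW hpQ hpT => hT.treeEquiv hpT hZ (hasContacts_Zer hpW.1 hpQ) hchar.1⟩
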